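/- **Theorem (model-based stable sparse recovery).** For a family $\mathcal M$ of subsets of $[n]$, call a vector $x'\in\mathbb R^n$ *$\mathcal M$-sparse* if its support is contained in a member of $\mathcal M$. Say that *recovery for $\mathcal M$ with $m$ measurements, approximation factor $F$ and decoding time $T$ is possible* if there are a matrix $A\in\mathbb R^{m\times n}$ and a decoder $D:\mathbb R^m\to\mathbb R^n$ such that $$\|x-D(Ax)\|_1\le F\cdot\min_{x'\ \mathcal M\text{-sparse}}\|x-x'\|_1\qquad\text{for all }x\in\mathbb R^n,$$ where $D$ (which may depend on $A$) is computed by an algebraic computation tree over $\mathbb R$ that performs at most $T$ steps on every input, a step being the loading of a real constant, an addition, subtraction or multiplication of two real numbers, or a comparison of two real numbers. There are absolute constants $c,C,K>0$ and $a\in\mathbb N$ such that the following holds for every $0<\varepsilon<1/2$. 1. (Block sparsity.) Let $1\le k\le n$ and $b\ge 2$ be integers with $b\mid k$ and $b\mid n$, let $[n]$ be partitioned into $n/b$ blocks of size $b$, and let $\mathcal B_{k,b}$ consist of all unions of $k/b$ blocks. Then recovery for $\mathcal B_{k,b}$ with approximation factor $3+c\,\varepsilon$ and decoding time $2^{an}$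 is possible with some number of measurements $$m\le \frac{C}{\varepsilon^2}\,k\,\bigl(1+\log_b(n/k)\bigr).$$ 2. (Tree sparsity.) Let $n=2^{h+1}-1$ with an integer $h\ge 0$, identify $[n]$ with the vertices of the full binary tree of depth $h$, and let $\mathcal T_k$ consist of all subtrees with $k$ vertices that contain the root. If $k\ge1$, $n/k>2$ and $k\ge K\log_2 n$ (so, in particular, if $k=\omega(\log n)$, $n/k>2$ and $n$ is large enough), then recovery for $\mathcal T_k$ with approximation factor $3+c\,\varepsilon$ and decoding time $2^{an}$ is possible with some number of measurements $$m\le \frac{C}{\varepsilon^2}\,k\cdot\frac{\log_2(n/k)}{\log_2\log_2(n/k)}.$$ In particular, for every fixed $\varepsilon$ the approximation factor is a constant $3+O(\varepsilon)$, the decoding time is exponential in $n$, and $m=O(k(1+\log_b(n/k)))$, respectively $m=O(k\log(n/k)/\log\log(n/k))$. -/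

import Mathlib

/-! ### Vectors, models, model-sparsity -/

/-- The `ℓ₁` norm on `ℝⁿ`. -/
def l1Norm {n : ℕ} (x : Fin n → ℝ) : ℝ := ∑ i, |x i|

/-- A vector is `M`-sparse, for a family `M` of supports, if its support lies within a member
of `M`. -/
def IsModelSparse {n : ℕ} (M : Set (Finset (Fin n))) (x : Fin n → ℝ) : Prop :=
  ∃ T ∈ M, ∀ i, x i ≠ 0 → i ∈ T

/-- `β` assigns to each coordinate its block; it is a partition of the `n` coordinates into `n / b`
blocks, each of size `b`. -/
def IsBlockPartition {n : ℕ} (b : ℕ) (β : Fin n → Fin (n / b)) : Prop :=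
  ∀ j, (Finset.univ.filter (fun i => β i = j)).card = b

/-- The block-sparse model: all unions of `k / b` blocks of the partition `β`. -/
def blockModel {n : ℕ} (k b : ℕ) (β : Fin n → Fin (n / b)) : Set (Finset (Fin n)) :=
  {S | ∃ J : Finset (Fin (n / b)), J.card = k / b ∧ S = Finset.univ.filter (fun i => β i ∈ J)}

/-- The parent relation of the full binary tree, with its vertices `0, …, n - 1` listed level by
level: the root is `0`, the children of `p` are `2 p + 1` and `2 p + 2`.
For `n = 2 ^ (h + 1) - 1` this is the full binary tree of depth `h`. -/
def IsTreeParent {n : ℕ} (p c : Fin n) : Prop :=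
  (c : ℕ) = 2 * (p : ℕ) + 1 ∨ (c : ℕ) = 2 * (p : ℕ) + 2

/-- The tree-sparse model: all subtrees with `k` vertices that contain the root, that is, vertex
sets of size `k` that contain the root and, with each vertex, its parent. -/
def treeModel (n k : ℕ) : Set (Finset (Fin n)) :=
  {S | S.card = k ∧ (∃ r ∈ S, (r : ℕ) = 0) ∧ ∀ p c : Fin n, IsTreeParent p c → c ∈ S → p ∈ S}

/-! ### Decoders: algebraic computation trees over `ℝ` with a step count -/

/-- The arithmetic operations that cost one step. -/
inductive ArithOp where
  | add
  | sub
  | mul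

/-- The value of an arithmetic operation. -/
def ArithOp.apply : ArithOp → ℝ → ℝ → ℝ
  | .add, u, v => u + v
  | .sub, u, v => u - v
  | .mul, u, v => u * v

/-- An algebraic computation tree that works on real registers indexed by `ℕ`.  Each node either
halts, loads a real constant, performs one arithmetic operation, or compares two registers and
branches. -/
inductive CompTree where
  | halt : CompTree
  /-- `const r c t`: put `c` into register `r`, continue with `t`. -/
  | const (r : ℕ) (c : ℝ) (t : CompTree) : CompTree
  /-- `arith o r i j t`: put `(register i) o (register j)` into register `r`, continue with `t`. -/
  | arith (o : ArithOp) (r i j : ℕ) (t : CompTree) : CompTree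
  /-- `branch i j t₁ t₂`: go to `t₁` if `register i ≤ register j`, to `t₂` otherwise. -/
  | branch (i j : ℕ) (t₁ t₂ : CompTree) : CompTree

/-- The contents of the registers when the computation halts, from the initial contents `s`. -/
noncomputable def CompTree.run : CompTree → (ℕ → ℝ) → (ℕ → ℝ)
  | .halt, s => s
  | .const r c t, s => t.run (Function.update s r c)
  | .arith o r i j t, s => t.run (Function.update s r (o.apply (s i) (s j)))
  | .branch i j t₁ t₂, s => if s i ≤ s j then t₁.run s else t₂.run s

/-- The number of steps (constants loaded, arithmetic operations and comparisons) that are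
executed from the initial contents `s`. -/
noncomputable def CompTree.steps : CompTree → (ℕ → ℝ) → ℕ
  | .halt, _ => 0
  | .const r c t, s => t.steps (Function.update s r c) + 1
  | .arith o r i j t, s => t.steps (Function.update s r (o.apply (s i) (s j))) + 1
  | .branch i j t₁ t₂, s => (if s i ≤ s j then t₁.steps s else t₂.steps s) + 1

/-- The initial registers: the input `y ∈ ℝᵐ` in registers `0, …, m - 1`, zeros elsewhere. -/
noncomputable def inputRegisters {m : ℕ} (y : Fin m → ℝ) : ℕ → ℝ :=
  fun i => if h : i < m then y ⟨i, h⟩ else 0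

/-- The decoder `ℝᵐ → ℝⁿ` given by a computation tree: the output is read from registers
`0, …, n - 1`. -/
noncomputable def CompTree.decode (t : CompTree) {m : ℕ} (n : ℕ) (y : Fin m → ℝ) : Fin n → ℝ :=
  fun i => t.run (inputRegisters y) i

/-! ### Model-based stable sparse recovery -/

/-- Model-based stable sparse recovery with the `ℓ₁/ℓ₁` guarantee for the model `M` can be solved
with `m` linear measurements, approximation factor `F`, and decoding time `T`: there are an
`m × n` matrix `A` and a decoder that makes at most `T` steps on each input and, from `y = A x`,
returns `x⋆` with `‖x - x⋆‖₁ ≤ F · min ‖x - x'‖₁`, the minimum being over all `M`-sparse `x'`. -/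
def StableRecovery {n : ℕ} (M : Set (Finset (Fin n))) (m : ℕ) (F : ℝ) (T : ℕ) : Prop :=
  ∃ (A : Matrix (Fin m) (Fin n) ℝ) (t : CompTree),
    (∀ y : Fin m → ℝ, t.steps (inputRegisters y) ≤ T) ∧
    ∀ x x' : Fin n → ℝ, IsModelSparse M x' →
      l1Norm (x - t.decode n (A.mulVec x)) ≤ F * l1Norm (x - x')

/-! ### Random functions with few collisions -/

/-! The matrix is the normalized adjacency matrix of a random bipartite multigraph of left degree
`d`. If every subset of a union of two model sets expands up to a loss `η`, then `(1 - 2η)‖z‖₁ ≤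
‖Az‖₁ ≤ ‖z‖₁` for `z` supported on such a union (`one_sub_mul_l1Norm_le`), the upper bound holding
for all `z`. Minimizing `‖y - Aw‖₁` over model-sparse `w` then recovers `x` with factor `1 + 2 / (1
- 2η)`, which is `3 + O(ε)` for `η = ε / 2` (`stableRecovery_of_l1_isometry`).

Such expanders come from a union bound (`exists_isModelExpander`). A set of size `s` fails with
probability at most `(12k/s) ^ (-5Λs)` when `d ≈ Λ/η` and `m ≈ dk/η`. The number of sets of size `s`
is bounded in two ways: by all `s`-subsets of the coordinates, which is good for small `s`, or by
the `s`-subsets of unions of two model sets, which is good for `s` near `k`. The least `Λ` for which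
one of the two always suffices, up to a constant, determines `m`; the crossover is at `k/s = b` for
blocks (`block_count`) and at `k/s = log₂(n/k)` for trees (`tree_count`).

The minimization is a finite search: an optimum is attained where the vanishing residuals determine
the vector within its support (`exists_vertex`), so it is the image of `y` under one of at most `2 ^
n * 2 ^ m` fixed linear maps. A computation tree evaluates and compares all of them
(`exists_compTree_select`). -/

/-- Choosing for each `w ∈ W` some `v ∈ V` with the same value, `f` is determined by this choice and
by its values off `W`. -/
theorem card_filter_image_subset_image {α β : Type*} [Fintype α] [Fintype β] [DecidableEq α]
    [DecidableEq β] (W V : Finset α) (hd : Disjoint W V) :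
    (Finset.univ.filter fun f : α → β => W.image f ⊆ V.image f).card ≤
      Fintype.card β ^ (Fintype.card α - W.card) * V.card ^ W.card := by
  classical
  have hV : ∀ v : V, (v : α) ∉ W := fun v hv => Finset.disjoint_left.1 hd hv v.2
  let Φ : (W → V) × ({a // a ∉ W} → β) → (α → β) := fun p a =>
    if ha : a ∈ W then p.2 ⟨p.1 ⟨a, ha⟩, hV _⟩ else p.2 ⟨a, ha⟩
  have hsub : (Finset.univ.filter fun f : α → β => W.image f ⊆ V.image f) ⊆
      Finset.univ.image Φ := by
    intro f hf
    have hf' : ∀ w : W, ∃ v : V, f v = f w := by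
      intro w
      have := (Finset.mem_filter.1 hf).2 (Finset.mem_image_of_mem f w.2)
      obtain ⟨v, hv, h⟩ := Finset.mem_image.1 this
      exact ⟨⟨v, hv⟩, h⟩
    choose g hg using hf'
    refine Finset.mem_image.2 ⟨(g, fun a => f a), Finset.mem_univ _, ?_⟩
    funext a
    by_cases ha : a ∈ W
    · simp only [Φ, ha, dif_pos]
      exact hg ⟨a, ha⟩
    · simp only [Φ, ha, dif_neg, not_false_eq_true]
  refine (Finset.card_le_card hsub).trans (Finset.card_image_le.trans ?_)
  have : Fintype.card {a // a ∉ W} = Fintype.card α - W.card := by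
    rw [Fintype.card_subtype_compl, Fintype.card_coe]
  rw [Finset.card_univ, Fintype.card_prod, Fintype.card_fun, Fintype.card_fun, this,
    Fintype.card_coe, Fintype.card_coe, mul_comm]

/-- Keep one representative of each value; any `q` of the remaining elements can serve as `W`. -/
theorem Finset.exists_subset_image_subset_image_sdiff {α β : Type*} [DecidableEq α]
    [DecidableEq β] (f : α → β) (E : Finset α) (q : ℕ) (h : q + (E.image f).card ≤ E.card) :
    ∃ W ⊆ E, W.card = q ∧ W.image f ⊆ (E \ W).image f := by
  obtain ⟨U, hUE, hinj, hU⟩ : ∃ U ⊆ E, Set.InjOn f U ∧ U.image f = E.image f := by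
    have := Set.exists_subset_bijOn (E : Set α) f
    obtain ⟨U, hU, hb⟩ := this
    have hfin : U.Finite := E.finite_toSet.subset hU
    refine ⟨hfin.toFinset, by simpa using hU, by simpa using hb.injOn, ?_⟩
    apply Finset.coe_injective
    simpa using hb.image_eq
  have hc : U.card = (E.image f).card := by rw [← hU, Finset.card_image_of_injOn hinj]
  have : q ≤ (E \ U).card := by rw [Finset.card_sdiff_of_subset hUE]; omega
  obtain ⟨W, hW, hWq⟩ := Finset.exists_subset_card_eq this
  refine ⟨W, hW.trans Finset.sdiff_subset, hWq, ?_⟩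
  have h1 : W.image f ⊆ U.image f := by
    rw [hU]; exact Finset.image_subset_image (hW.trans Finset.sdiff_subset)
  refine h1.trans (Finset.image_subset_image ?_)
  intro u hu
  exact Finset.mem_sdiff.2 ⟨hUE hu, fun hw => (Finset.mem_sdiff.1 (hW hw)).2 hu⟩

theorem card_filter_collisions_le {α β : Type*} [Fintype α] [Fintype β] [DecidableEq α]
    [DecidableEq β] (E : Finset α) (q : ℕ) :
    (Finset.univ.filter fun f : α → β => q + (E.image f).card ≤ E.card).card ≤
      E.card.choose q * (Fintype.card β ^ (Fintype.card α - q) * E.card ^ q) := by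
  have hsub : (Finset.univ.filter fun f : α → β => q + (E.image f).card ≤ E.card) ⊆
      (E.powersetCard q).biUnion fun W =>
        Finset.univ.filter fun f : α → β => W.image f ⊆ (E \ W).image f := by
    intro f hf
    obtain ⟨W, hW, hq, h⟩ :=
      Finset.exists_subset_image_subset_image_sdiff f E q (Finset.mem_filter.1 hf).2
    exact Finset.mem_biUnion.2 ⟨W, Finset.mem_powersetCard.2 ⟨hW, hq⟩,
      Finset.mem_filter.2 ⟨Finset.mem_univ _, h⟩⟩
  refine (Finset.card_le_card hsub).trans ?_
  rw [← Finset.card_powersetCard]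
  refine Finset.card_biUnion_le_card_mul _ _ _ fun W hW => ?_
  obtain ⟨hWE, hq⟩ := Finset.mem_powersetCard.1 hW
  refine (card_filter_image_subset_image W (E \ W) Finset.disjoint_sdiff).trans ?_
  rw [hq]
  gcongr
  exact Finset.sdiff_subset

theorem Nat.choose_le_exp_mul_div_pow (n k : ℕ) :
    (n.choose k : ℝ) ≤ (Real.exp 1 * n / k) ^ k := by
  rcases Nat.eq_zero_or_pos k with rfl | hk
  · simp
  have hk' : (0 : ℝ) < k := by exact_mod_cast hk
  have h1 : (n.choose k : ℝ) ≤ (n : ℝ) ^ k / (k.factorial : ℝ) := Nat.choose_le_pow_div k n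
  have h2 : (k : ℝ) ^ k / (k.factorial : ℝ) ≤ Real.exp k :=
    Real.pow_div_factorial_le_exp k hk'.le k
  have hf : (0 : ℝ) < k.factorial := by exact_mod_cast k.factorial_pos
  refine h1.trans ?_
  rw [div_pow, mul_pow, ← Real.exp_nat_mul, mul_one, le_div_iff₀ (by positivity)]
  calc (n : ℝ) ^ k / (k.factorial : ℝ) * (k : ℝ) ^ k
      = (n : ℝ) ^ k * ((k : ℝ) ^ k / (k.factorial : ℝ)) := by ring
    _ ≤ (n : ℝ) ^ k * Real.exp k := by gcongr
    _ = Real.exp k * n ^ k := by ring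

/-- The probability, for a random function on `E`, of at least `q ≥ η |E|` collisions. -/
theorem card_filter_collisions_le_pow {α β : Type*} [Fintype α] [Fintype β] [DecidableEq α]
    [DecidableEq β] [Nonempty β] (E : Finset α) (q : ℕ) (η : ℝ) (hη : 0 < η)
    (hq : η * E.card ≤ q) (hqE : q ≤ E.card) (hE : 0 < E.card) :
    ((Finset.univ.filter fun f : α → β => q + (E.image f).card ≤ E.card).card : ℝ) ≤
      (Real.exp 1 * E.card / (η * Fintype.card β)) ^ q *
        (Fintype.card β : ℝ) ^ (Fintype.card α) := by
  have hb : (0 : ℝ) < Fintype.card β := by exact_mod_cast Fintype.card_pos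
  have hE' : (0 : ℝ) < E.card := by exact_mod_cast hE
  have hq0 : (0 : ℝ) < q := lt_of_lt_of_le (by positivity) hq
  have hqα : q ≤ Fintype.card α := hqE.trans (Finset.card_le_univ E)
  have h1 : ((Finset.univ.filter fun f : α → β => q + (E.image f).card ≤ E.card).card : ℝ) ≤
      (E.card.choose q : ℝ) * ((Fintype.card β : ℝ) ^ (Fintype.card α - q) * (E.card : ℝ) ^ q) := by
    exact_mod_cast card_filter_collisions_le (β := β) E q
  refine h1.trans ?_
  have h2 : (E.card.choose q : ℝ) ≤ (Real.exp 1 / η) ^ q := by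
    refine (Nat.choose_le_exp_mul_div_pow _ _).trans ?_
    gcongr ?_ ^ q
    rw [div_le_div_iff₀ hq0 hη]
    have := Real.exp_pos 1
    nlinarith
  calc (E.card.choose q : ℝ) * ((Fintype.card β : ℝ) ^ (Fintype.card α - q) * (E.card : ℝ) ^ q)
      ≤ (Real.exp 1 / η) ^ q *
        ((Fintype.card β : ℝ) ^ (Fintype.card α - q) * (E.card : ℝ) ^ q) := by gcongr
    _ = (Real.exp 1 * E.card / (η * Fintype.card β)) ^ q *
        ((Fintype.card β : ℝ) ^ (Fintype.card α - q) * (Fintype.card β : ℝ) ^ q) := by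
        rw [div_pow, div_pow, mul_pow, mul_pow]
        field_simp
    _ = _ := by rw [← pow_add, Nat.sub_add_cancel hqα]

/-! ### Model expanders -/

/-- The multigraph `f`, of left degree `d`, expands every subset of a union of two members of `M`
up to a loss of `η`. -/
def IsModelExpander {n d m : ℕ} (M : Set (Finset (Fin n))) (η : ℝ) (f : Fin n × Fin d → Fin m) :
    Prop :=
  ∀ T₁ ∈ M, ∀ T₂ ∈ M, ∀ S ⊆ T₁ ∪ T₂,
    (1 - η) * (d * S.card) ≤ (((S ×ˢ Finset.univ).image f).card : ℝ)

theorem Finset.sum_Icc_half_pow_lt_one (n : ℕ) :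
    ∑ s ∈ Finset.Icc 1 n, (1 / 2 : ℝ) ^ s < 1 := by
  have : ∑ s ∈ Finset.Icc 1 n, (1 / 2 : ℝ) ^ s = 1 - (1 / 2) ^ n := by
    induction n with
    | zero => simp
    | succ n ih => rw [Finset.sum_Icc_succ_top (by omega), ih]; ring
  rw [this]
  have : (0 : ℝ) < (1 / 2) ^ n := by positivity
  linarith

open Classical in
/-- The nonempty subsets of unions of two members of `M`. -/
noncomputable def pairSubsets {n : ℕ} (M : Set (Finset (Fin n))) : Finset (Finset (Fin n)) :=
  Finset.univ.filter fun S => S.Nonempty ∧ ∃ T₁ ∈ M, ∃ T₂ ∈ M, S ⊆ T₁ ∪ T₂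

theorem card_pairSubsets_le_choose {n : ℕ} (M : Set (Finset (Fin n))) (s : ℕ) :
    ((pairSubsets M).filter fun S => S.card = s).card ≤ n.choose s := by
  have : ((pairSubsets M).filter fun S => S.card = s) ⊆ Finset.univ.powersetCard s := by
    intro S hS
    exact Finset.mem_powersetCard.2 ⟨Finset.subset_univ _, (Finset.mem_filter.1 hS).2⟩
  simpa using Finset.card_le_card this

theorem card_pairSubsets_le_ncard {n k : ℕ} (M : Set (Finset (Fin n)))
    (hM : ∀ T ∈ M, T.card ≤ k) (s : ℕ) :
    ((pairSubsets M).filter fun S => S.card = s).card ≤ M.ncard ^ 2 * (2 * k).choose s := by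
  classical
  have hsub : ((pairSubsets M).filter fun S => S.card = s) ⊆
      (M.toFinset ×ˢ M.toFinset).biUnion fun p => (p.1 ∪ p.2).powersetCard s := by
    intro S hS
    simp only [pairSubsets, Finset.mem_filter, Finset.mem_univ, true_and] at hS
    obtain ⟨⟨-, T₁, h₁, T₂, h₂, h⟩, hs⟩ := hS
    refine Finset.mem_biUnion.2 ⟨(T₁, T₂), by simp [h₁, h₂], ?_⟩
    exact Finset.mem_powersetCard.2 ⟨h, hs⟩
  refine (Finset.card_le_card hsub).trans ?_
  refine (Finset.card_biUnion_le_card_mul _ _ ((2 * k).choose s) ?_).trans ?_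
  · rintro ⟨T₁, T₂⟩ hp
    simp only [Finset.mem_product, Set.mem_toFinset] at hp
    rw [Finset.card_powersetCard]
    apply Nat.choose_le_choose
    have := hM _ hp.1
    have := hM _ hp.2
    have := Finset.card_union_le T₁ T₂
    simp only
    omega
  · rw [Finset.card_product, Set.ncard_eq_toFinset_card', sq]

/-- Union bound over the nonempty subsets of unions of two model sets, grouped by size `s`; each
group contributes at most `2 ^ (-s)` to the failure probability. The two alternatives in `hcount`
correspond to the two ways of counting a group. -/
theorem exists_isModelExpander {n d m k : ℕ} (M : Set (Finset (Fin n))) (η Λ : ℝ) (hη : 0 < η)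
    (hη1 : η < 1) (hk : 1 ≤ k) (hM : ∀ T ∈ M, T.card ≤ k) (hΛ : 1 ≤ Λ) (hd : 5 * Λ ≤ η * d)
    (hm : 12 * Real.exp 1 * d * k ≤ η * m)
    (hcount : ∀ s : ℕ, 1 ≤ s → s ≤ 2 * k →
      (n / k : ℝ) ≤ (12 * k / s : ℝ) ^ Λ ∨ (M.ncard : ℝ) ≤ (12 * k / s : ℝ) ^ (2 * Λ * s)) :
    ∃ f : Fin n × Fin d → Fin m, IsModelExpander M η f := by
  classical
  have he := Real.exp_pos 1
  have he3 : Real.exp 1 < 3 := Real.exp_one_lt_three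
  have hk' : (1 : ℝ) ≤ k := by exact_mod_cast hk
  have hd0 : (0 : ℝ) < d := by
    by_contra h
    nlinarith
  have hd1 : 0 < d := by exact_mod_cast hd0
  have hm0 : (0 : ℝ) < m := by
    have h1 : 0 < 12 * Real.exp 1 * d * k := by positivity
    by_contra h
    nlinarith
  have hm1 : 0 < m := by exact_mod_cast hm0
  have : Nonempty (Fin m) := ⟨⟨0, hm1⟩⟩
  let E : Finset (Fin n) → Finset (Fin n × Fin d) := fun S => S ×ˢ Finset.univ
  have hE : ∀ S, (E S).card = S.card * d := fun S => by simp [E, Finset.card_product]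
  let q : ℕ → ℕ := fun s => ⌈η * (s * d : ℕ)⌉₊
  let bad : Finset (Fin n) → Finset (Fin n × Fin d → Fin m) := fun S =>
    Finset.univ.filter fun f => q S.card + ((E S).image f).card ≤ (E S).card
  have hsize : ∀ S ∈ pairSubsets M, 1 ≤ S.card ∧ S.card ≤ 2 * k := by
    intro S hS
    simp only [pairSubsets, Finset.mem_filter, Finset.mem_univ, true_and] at hS
    obtain ⟨hne, T₁, h₁, T₂, h₂, h⟩ := hS
    refine ⟨Finset.card_pos.2 hne, (Finset.card_le_card h).trans
      ((Finset.card_union_le _ _).trans ?_)⟩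
    have := hM _ h₁
    have := hM _ h₂
    omega
  set tot : ℝ := (m : ℝ) ^ (n * d) with htot
  have htot0 : 0 < tot := by positivity
  have hbad : ∀ S ∈ pairSubsets M,
      ((bad S).card : ℝ) ≤ (12 * k / S.card : ℝ) ^ (-(5 * Λ * S.card)) * tot := by
    intro S hS
    obtain ⟨h1, h2⟩ := hsize S hS
    have h1' : (1 : ℝ) ≤ S.card := by exact_mod_cast h1
    have h2' : (S.card : ℝ) ≤ 2 * k := by exact_mod_cast h2
    have hEpos : 0 < (E S).card := by rw [hE]; positivity
    have hqE : q S.card ≤ (E S).card := by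
      apply Nat.ceil_le.2
      rw [hE]
      have : (0 : ℝ) ≤ (S.card * d : ℕ) := Nat.cast_nonneg _
      nlinarith
    have hq : η * (E S).card ≤ q S.card := by rw [hE]; exact Nat.le_ceil _
    refine (card_filter_collisions_le_pow (E S) (q S.card) η hη hq hqE hEpos).trans ?_
    simp only [Fintype.card_fin, Fintype.card_prod]
    refine mul_le_mul_of_nonneg_right ?_ htot0.le
    -- This is where `m ≥ 12 e d k / η` enters: the base of the collision bound becomes `s / (12k)`,
    -- at most `1/6` since `s ≤ 2k`.
    have hbase : Real.exp 1 * ((E S).card : ℝ) / (η * m) ≤ (12 * k / S.card : ℝ)⁻¹ := by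
      rw [hE, inv_div, div_le_div_iff₀ (by positivity) (by positivity)]
      push_cast
      nlinarith
    have hY : (1 : ℝ) ≤ 12 * k / S.card := by
      rw [le_div_iff₀ (by positivity)]; linarith
    calc (Real.exp 1 * ((E S).card : ℝ) / (η * m)) ^ q S.card
        ≤ ((12 * k / S.card : ℝ)⁻¹) ^ q S.card := by gcongr
      _ = (12 * k / S.card : ℝ) ^ (-(q S.card : ℝ)) := by
          rw [Real.rpow_neg (by positivity), Real.rpow_natCast, inv_pow]
      _ ≤ _ := by
          apply Real.rpow_le_rpow_of_exponent_le hY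
          rw [neg_le_neg_iff]
          refine le_trans ?_ hq
          rw [hE]
          push_cast
          nlinarith
  have hcnt : ∀ s ∈ Finset.Icc 1 n,
      (((pairSubsets M).filter fun S => S.card = s).card : ℝ) *
        (12 * k / s : ℝ) ^ (-(5 * Λ * s)) ≤ (1 / 2) ^ s := by
    intro s hs
    have h1 := (Finset.mem_Icc.1 hs).1
    by_cases h2 : s ≤ 2 * k
    swap
    · have : (pairSubsets M).filter (fun S => S.card = s) = ∅ := by
        apply Finset.filter_eq_empty_iff.2
        intro S hS h
        have := (hsize S hS).2
        omega
      rw [this]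
      simp
    have h1' : (1 : ℝ) ≤ s := by exact_mod_cast h1
    have h2' : (s : ℝ) ≤ 2 * k := by exact_mod_cast h2
    have hY : (1 : ℝ) ≤ 12 * k / s := by
      rw [le_div_iff₀ (by positivity)]; linarith
    have hY0 : (0 : ℝ) < 12 * k / s := by positivity
    rw [Real.rpow_neg hY0.le, ← div_eq_mul_inv, div_le_iff₀ (by positivity)]
    rw [one_div, inv_pow, ← div_eq_inv_mul, le_div_iff₀ (by positivity)]
    rcases hcount s h1 h2 with h | h
    · have h3 : (((pairSubsets M).filter fun S => S.card = s).card : ℝ) ≤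
          (Real.exp 1 * n / s) ^ s :=
        le_trans (by exact_mod_cast card_pairSubsets_le_choose M s)
          (Nat.choose_le_exp_mul_div_pow n s)
      calc (((pairSubsets M).filter fun S => S.card = s).card : ℝ) * 2 ^ s
          ≤ (Real.exp 1 * n / s) ^ s * 2 ^ s := by gcongr
        _ = ((2 * Real.exp 1 * (k / s)) * (n / k : ℝ)) ^ s := by
            rw [← mul_pow]; congr 1; field_simp
        _ ≤ ((12 * k / s : ℝ) ^ (1 : ℝ) * (12 * k / s : ℝ) ^ Λ) ^ s := by
            gcongr
            rw [Real.rpow_one, mul_div_assoc]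
            gcongr
            linarith
        _ = (12 * k / s : ℝ) ^ ((1 + Λ) * s) := by
            rw [← Real.rpow_add hY0, Real.rpow_mul hY0.le, Real.rpow_natCast]
        _ ≤ _ := by
            apply Real.rpow_le_rpow_of_exponent_le hY
            gcongr
            linarith
    · have h3 : (((pairSubsets M).filter fun S => S.card = s).card : ℝ) ≤
          (M.ncard : ℝ) ^ 2 * (Real.exp 1 * (2 * k : ℕ) / s) ^ s :=
        le_trans (by exact_mod_cast card_pairSubsets_le_ncard M hM s)
          (mul_le_mul_of_nonneg_left (Nat.choose_le_exp_mul_div_pow (2 * k) s) (by positivity))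
      calc (((pairSubsets M).filter fun S => S.card = s).card : ℝ) * 2 ^ s
          ≤ ((M.ncard : ℝ) ^ 2 * (Real.exp 1 * (2 * k : ℕ) / s) ^ s) * 2 ^ s := by gcongr
        _ = (M.ncard : ℝ) ^ 2 * ((4 * Real.exp 1) * (k / s)) ^ s := by
            rw [mul_assoc, ← mul_pow]; congr 2; push_cast; ring
        -- The constant `12` is chosen so that `4e < 12`: the factors `2 ^ s` and `(2ek/s) ^ s`
        -- together cost one power `(12k/s) ^ s`.
        _ ≤ ((12 * k / s : ℝ) ^ (2 * Λ * s)) ^ 2 * (12 * k / s : ℝ) ^ s := by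
            gcongr
            rw [mul_div_assoc]
            gcongr
            linarith
        _ = (12 * k / s : ℝ) ^ (4 * Λ * s + s) := by
            rw [Real.rpow_add hY0, Real.rpow_natCast, ← Real.rpow_mul_natCast hY0.le]
            congr 2
            push_cast
            ring
        _ ≤ _ := by
            -- The exponent `4Λs + s` is at most `5Λs` because `Λ ≥ 1`; hence the `5` in `hd`.
            apply Real.rpow_le_rpow_of_exponent_le hY
            nlinarith
  have hsum : (∑ S ∈ pairSubsets M, ((bad S).card : ℝ)) < tot := by
    calc (∑ S ∈ pairSubsets M, ((bad S).card : ℝ))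
        ≤ ∑ S ∈ pairSubsets M, (12 * k / S.card : ℝ) ^ (-(5 * Λ * S.card)) * tot :=
          Finset.sum_le_sum hbad
      _ = ∑ s ∈ Finset.Icc 1 n, ∑ S ∈ (pairSubsets M).filter (fun S => S.card = s),
            (12 * k / S.card : ℝ) ^ (-(5 * Λ * S.card)) * tot := by
          rw [Finset.sum_fiberwise_of_maps_to]
          intro S hS
          exact Finset.mem_Icc.2 ⟨(hsize S hS).1, by simpa using Finset.card_le_univ S⟩
      _ = ∑ s ∈ Finset.Icc 1 n, (((pairSubsets M).filter fun S => S.card = s).card : ℝ) *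
            (12 * k / s : ℝ) ^ (-(5 * Λ * s)) * tot := by
          refine Finset.sum_congr rfl fun s _ => ?_
          rw [mul_assoc, ← nsmul_eq_mul, ← Finset.sum_const]
          refine Finset.sum_congr rfl fun S hS => ?_
          rw [(Finset.mem_filter.1 hS).2]
      _ ≤ ∑ s ∈ Finset.Icc 1 n, (1 / 2 : ℝ) ^ s * tot :=
          Finset.sum_le_sum fun s hs => mul_le_mul_of_nonneg_right (hcnt s hs) htot0.le
      _ < tot := by
          rw [← Finset.sum_mul]
          nlinarith [Finset.sum_Icc_half_pow_lt_one n]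
  have hex : ∃ f, f ∉ (pairSubsets M).biUnion bad := by
    by_contra! hall
    have h1 : Fintype.card (Fin n × Fin d → Fin m) ≤ ∑ S ∈ pairSubsets M, (bad S).card := by
      rw [← Finset.card_univ]
      exact (Finset.card_le_card fun f _ => hall f).trans Finset.card_biUnion_le
    have h2 : tot ≤ ∑ S ∈ pairSubsets M, ((bad S).card : ℝ) := by
      have : ((Fintype.card (Fin n × Fin d → Fin m) : ℕ) : ℝ) ≤
        ((∑ S ∈ pairSubsets M, (bad S).card : ℕ) : ℝ) := by exact_mod_cast h1
      simpa [tot] using this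
    linarith
  obtain ⟨f, hf⟩ := hex
  refine ⟨f, fun T₁ h₁ T₂ h₂ S hS => ?_⟩
  rcases S.eq_empty_or_nonempty with rfl | hne
  · simp
  have hSF : S ∈ pairSubsets M := by
    simp only [pairSubsets, Finset.mem_filter, Finset.mem_univ, true_and]
    exact ⟨hne, T₁, h₁, T₂, h₂, hS⟩
  by_contra! hlt
  apply hf
  refine Finset.mem_biUnion.2 ⟨S, hSF, Finset.mem_filter.2 ⟨Finset.mem_univ _, ?_⟩⟩
  have hle : ((E S).image f).card ≤ (E S).card := Finset.card_image_le
  have : q S.card ≤ (E S).card - ((E S).image f).card := by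
    apply Nat.ceil_le.2
    rw [Nat.cast_sub hle, hE]
    push_cast
    simp only [E]
    linarith
  omega

/-! ### The `ℓ₁` isometry property of expanders -/

theorem l1Norm_nonneg {n : ℕ} (x : Fin n → ℝ) : 0 ≤ l1Norm x :=
  Finset.sum_nonneg fun _ _ => abs_nonneg _

theorem l1Norm_add_le {n : ℕ} (x y : Fin n → ℝ) : l1Norm (x + y) ≤ l1Norm x + l1Norm y := by
  rw [l1Norm, l1Norm, l1Norm, ← Finset.sum_add_distrib]
  exact Finset.sum_le_sum fun i _ => abs_add_le _ _

theorem l1Norm_neg {n : ℕ} (x : Fin n → ℝ) : l1Norm (-x) = l1Norm x := by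
  simp [l1Norm]

theorem eq_zero_of_l1Norm_le_zero {n : ℕ} {x : Fin n → ℝ} (h : l1Norm x ≤ 0) : x = 0 := by
  have h0 : l1Norm x = 0 := le_antisymm h (l1Norm_nonneg x)
  funext i
  have := (Finset.sum_eq_zero_iff_of_nonneg fun i _ => abs_nonneg (x i)).1 h0 i (Finset.mem_univ i)
  simpa using this

/-- The normalized adjacency matrix of the multigraph `f` of left degree `d`. -/
noncomputable def adjacencyMatrix {n d m : ℕ} (f : Fin n × Fin d → Fin m) :
    Matrix (Fin m) (Fin n) ℝ :=
  fun r i => (d : ℝ)⁻¹ * ∑ j : Fin d, if f (i, j) = r then 1 else 0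

theorem mul_adjacencyMatrix_mulVec {n d m : ℕ} (hd : 0 < d) (f : Fin n × Fin d → Fin m)
    (z : Fin n → ℝ) (r : Fin m) :
    d * (adjacencyMatrix f).mulVec z r =
      ∑ e ∈ Finset.univ.filter (fun e => f e = r), z e.1 := by
  have hd' : (d : ℝ) ≠ 0 := by positivity
  rw [Finset.sum_filter, Fintype.sum_prod_type, Matrix.mulVec, dotProduct, Finset.mul_sum]
  refine Finset.sum_congr rfl fun i _ => ?_
  rw [adjacencyMatrix, ← mul_assoc, mul_inv_cancel_left₀ hd', Finset.sum_mul]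
  refine Finset.sum_congr rfl fun j _ => ?_
  split_ifs <;> simp

theorem sum_filter_abs {n d m : ℕ} (f : Fin n × Fin d → Fin m) (z : Fin n → ℝ) :
    ∑ r, ∑ e ∈ Finset.univ.filter (fun e => f e = r), |z e.1| = d * l1Norm z := by
  rw [Finset.sum_fiberwise, Fintype.sum_prod_type, l1Norm, Finset.mul_sum]
  simp

theorem l1Norm_adjacencyMatrix_mulVec_le {n d m : ℕ} (hd : 0 < d) (f : Fin n × Fin d → Fin m)
    (z : Fin n → ℝ) : l1Norm ((adjacencyMatrix f).mulVec z) ≤ l1Norm z := by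
  have hd' : (0 : ℝ) < d := by exact_mod_cast hd
  refine le_of_mul_le_mul_left ?_ hd'
  rw [← sum_filter_abs f z, l1Norm, Finset.mul_sum]
  refine Finset.sum_le_sum fun r _ => ?_
  have h : (d : ℝ) * |(adjacencyMatrix f).mulVec z r| = |d * (adjacencyMatrix f).mulVec z r| := by
    rw [abs_mul, abs_of_pos hd']
  rw [h, mul_adjacencyMatrix_mulVec hd]
  exact Finset.abs_sum_le_sum_abs _ _

/-- Layer-cake comparison: a bound between the sizes of the superlevel sets sums up. -/
theorem mul_sum_le_sum_of_card_superlevel_le {ι κ : Type*} [Fintype ι] [Fintype κ] (c : ℝ)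
    (u : ι → ℝ) (v : κ → ℝ) (hu : ∀ i, 0 ≤ u i) (hv : ∀ r, 0 ≤ v r)
    (h : ∀ t, 0 ≤ t → c * ((Finset.univ.filter fun i => t < u i).card : ℝ) ≤
      ((Finset.univ.filter fun r => t < v r).card : ℝ)) :
    c * ∑ i, u i ≤ ∑ r, v r := by
  -- The cutoff `B` gives the layers a domain of finite measure, on which their indicators are
  -- integrable.
  obtain ⟨B, hBu, hBv⟩ : ∃ B : ℝ, (∀ i, u i ≤ B) ∧ ∀ r, v r ≤ B := by
    refine ⟨∑ i, u i + ∑ r, v r, fun i => ?_, fun r => ?_⟩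
    · have := Finset.single_le_sum (fun i _ => hu i) (Finset.mem_univ i)
      have := Finset.sum_nonneg fun r (_ : r ∈ Finset.univ) => hv r
      linarith
    · have := Finset.single_le_sum (fun i _ => hv i) (Finset.mem_univ r)
      have := Finset.sum_nonneg fun r (_ : r ∈ Finset.univ) => hu r
      linarith
  have hind : ∀ x : ℝ, MeasureTheory.Integrable (fun t : ℝ => if t < x then (1 : ℝ) else 0)
      (MeasureTheory.volume.restrict (Set.Ico 0 B)) := by
    intro x
    have : (fun t : ℝ => if t < x then (1 : ℝ) else 0) = (Set.Iio x).indicator 1 := by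
      funext t; simp [Set.indicator_apply]
    rw [this]
    exact (MeasureTheory.integrable_const (1 : ℝ)).indicator measurableSet_Iio
  have hint : ∀ x : ℝ, 0 ≤ x → x ≤ B →
      ∫ t in Set.Ico 0 B, (if t < x then (1 : ℝ) else 0) = x := by
    intro x hx hxB
    have : (fun t : ℝ => if t < x then (1 : ℝ) else 0) = (Set.Iio x).indicator 1 := by
      funext t; simp [Set.indicator_apply]
    rw [this, MeasureTheory.integral_indicator_one measurableSet_Iio,
      MeasureTheory.measureReal_restrict_apply measurableSet_Iio]
    have : Set.Iio x ∩ Set.Ico 0 B = Set.Ico 0 x := by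
      ext t
      simp only [Set.mem_inter_iff, Set.mem_Iio, Set.mem_Ico]
      constructor
      · rintro ⟨a, b, c⟩; exact ⟨b, a⟩
      · rintro ⟨a, b⟩; exact ⟨b, a, by linarith⟩
    rw [this]
    simp [hx]
  have e1 : c * ∑ i, u i =
      ∫ t in Set.Ico 0 B, c * ∑ i, (if t < u i then (1 : ℝ) else 0) := by
    rw [MeasureTheory.integral_const_mul, MeasureTheory.integral_finsetSum _ fun i _ => hind _]
    congr 1
    exact Finset.sum_congr rfl fun i _ => (hint _ (hu i) (hBu i)).symm
  have e2 : ∑ r, v r = ∫ t in Set.Ico 0 B, ∑ r, (if t < v r then (1 : ℝ) else 0) := by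
    rw [MeasureTheory.integral_finsetSum _ fun i _ => hind _]
    exact Finset.sum_congr rfl fun i _ => (hint _ (hv i) (hBv i)).symm
  rw [e1, e2]
  refine MeasureTheory.setIntegral_mono_on ?_ ?_ measurableSet_Ico fun t ht => ?_
  · exact (MeasureTheory.integrable_finsetSum _ fun i _ => hind _).const_mul c
  · exact MeasureTheory.integrable_finsetSum _ fun i _ => hind _
  · have := h t ht.1
    simpa [Finset.sum_boole] using this

/-- In each row, cancellation against the largest entry loses at most the others: the sum is at
least `2 max - (sum of absolute values)`. Expansion of the superlevel sets of `|z|` makes the row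
maxima add up to at least `(1 - η) d ‖z‖₁`, while the absolute values add up to `d ‖z‖₁`. -/
theorem one_sub_mul_l1Norm_le {n d m : ℕ} (hd : 0 < d) (f : Fin n × Fin d → Fin m) (η : ℝ)
    (T : Finset (Fin n))
    (hf : ∀ S ⊆ T, (1 - η) * (d * S.card) ≤ (((S ×ˢ Finset.univ).image f).card : ℝ))
    (z : Fin n → ℝ) (hz : ∀ i, z i ≠ 0 → i ∈ T) :
    (1 - 2 * η) * l1Norm z ≤ l1Norm ((adjacencyMatrix f).mulVec z) := by
  classical
  have hd' : (0 : ℝ) < d := by exact_mod_cast hd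
  have hmax : ∀ r : Fin m, ∃ w : ℝ, 0 ≤ w ∧ (∀ e, f e = r → |z e.1| ≤ w) ∧
      2 * w - ∑ e ∈ Finset.univ.filter (fun e => f e = r), |z e.1| ≤
        |d * (adjacencyMatrix f).mulVec z r| := by
    intro r
    rw [mul_adjacencyMatrix_mulVec hd]
    set F := Finset.univ.filter (fun e => f e = r) with hF
    rcases F.eq_empty_or_nonempty with h0 | hne
    · refine ⟨0, le_rfl, fun e he => ?_, by simp [h0]⟩
      have : e ∈ F := by simp [hF, he]
      simp [h0] at this
    · obtain ⟨e₀, he₀, hmx⟩ := Finset.exists_max_image F (fun e => |z e.1|) hne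
      refine ⟨|z e₀.1|, abs_nonneg _, fun e he => hmx e (by simp [hF, he]), ?_⟩
      rw [← Finset.add_sum_erase F _ he₀, ← Finset.add_sum_erase F _ he₀]
      have h1 : |∑ e ∈ F.erase e₀, z e.1| ≤ ∑ e ∈ F.erase e₀, |z e.1| :=
        Finset.abs_sum_le_sum_abs _ _
      have h2 := abs_sub_abs_le_abs_sub (z e₀.1) (-∑ e ∈ F.erase e₀, z e.1)
      rw [abs_neg, sub_neg_eq_add] at h2
      linarith
  choose w hw0 hwe hw using hmax
  have hlayer : ((1 - η) * d) * ∑ i, |z i| ≤ ∑ r, w r := by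
    refine mul_sum_le_sum_of_card_superlevel_le _ _ _ (fun i => abs_nonneg _) hw0 fun t ht => ?_
    have hS : (Finset.univ.filter fun i => t < |z i|) ⊆ T := by
      intro i hi
      apply hz
      have := (Finset.mem_filter.1 hi).2
      exact abs_pos.1 (ht.trans_lt this)
    rw [mul_assoc]
    refine (hf _ hS).trans ?_
    norm_cast
    refine Finset.card_le_card fun r hr => ?_
    obtain ⟨e, he, rfl⟩ := Finset.mem_image.1 hr
    have h1 : t < |z e.1| := by simpa using (Finset.mem_product.1 he).1
    exact Finset.mem_filter.2 ⟨Finset.mem_univ _, h1.trans_le (hwe _ e rfl)⟩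
  have htot : ∑ r, (2 * w r - ∑ e ∈ Finset.univ.filter (fun e => f e = r), |z e.1|) ≤
      d * l1Norm ((adjacencyMatrix f).mulVec z) := by
    rw [l1Norm, Finset.mul_sum]
    refine Finset.sum_le_sum fun r _ => (hw r).trans ?_
    rw [abs_mul, abs_of_pos hd']
  rw [Finset.sum_sub_distrib, ← Finset.mul_sum, sum_filter_abs] at htot
  refine le_of_mul_le_mul_left ?_ hd'
  have : ∑ i, |z i| = l1Norm z := rfl
  rw [this] at hlayer
  linarith

/-! ### Least absolute deviations: an optimum is attained at a vertex -/

/-- On a line, a sum of absolute values of affine functions does not increase on the way to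
a suitable zero of one of them. -/
theorem exists_breakpoint_sum_abs_le {ι : Type*} [Fintype ι] (a b : ι → ℝ)
    (h0 : ∀ r, b r ≠ 0 → a r ≠ 0)
    (hb : ∃ r, b r ≠ 0) :
    ∃ t : ℝ, (∃ r, b r ≠ 0 ∧ a r - t * b r = 0) ∧ ∑ r, |a r - t * b r| ≤ ∑ r, |a r| := by
  classical
  -- Up to reversing the direction, the derivative `-∑ sign(a r) b r` of the sum at `t = 0` is
  -- nonpositive.
  wlog hσ : 0 ≤ ∑ r, SignType.sign (a r) * b r generalizing b
  · obtain ⟨t, ⟨r, hr, hr'⟩, ht⟩ := this (fun r => -b r) (fun r hr => h0 r (by simpa using hr))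
      (by simpa using hb) (by
        simp only [mul_neg, Finset.sum_neg_distrib]
        linarith)
    refine ⟨-t, ⟨r, by simpa using hr, ?_⟩, ?_⟩
    · simpa using hr'
    · simpa using ht
  let P := Finset.univ.filter fun r => b r ≠ 0 ∧ 0 < a r / b r
  -- Without a breakpoint at positive `t`, every nonconstant term would increase, contradicting the
  -- sign of the derivative.
  have hP : P.Nonempty := by
    by_contra hne
    rw [Finset.not_nonempty_iff_eq_empty, Finset.filter_eq_empty_iff] at hne
    have hterm : ∀ r, (SignType.sign (a r) : ℝ) * b r = -|b r| := by
      intro r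
      by_cases hr : b r = 0
      · simp [hr]
      have h1 := hne (Finset.mem_univ r)
      simp only [not_and, not_lt] at h1
      have h2 := h1 hr
      rcases lt_or_gt_of_ne (h0 r hr) with ha | ha
      · have : 0 < b r := by
          rcases lt_or_gt_of_ne hr with hb' | hb'
          · exact absurd (div_pos_of_neg_of_neg ha hb') (not_lt.2 h2)
          · exact hb'
        rw [sign_neg ha, abs_of_pos this]; simp
      · have : b r < 0 := by
          rcases lt_or_gt_of_ne hr with hb' | hb'
          · exact hb'
          · exact absurd (div_pos ha hb') (not_lt.2 h2)
        rw [sign_pos ha, abs_of_neg this]; simp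
    simp only [hterm, Finset.sum_neg_distrib] at hσ
    obtain ⟨r, hr⟩ := hb
    have := Finset.single_le_sum (fun r _ => abs_nonneg (b r)) (Finset.mem_univ r)
    have := abs_pos.2 hr
    linarith
  obtain ⟨r₀, hr₀, hmin⟩ := Finset.exists_min_image P (fun r => a r / b r) hP
  obtain ⟨hb₀, hpos⟩ := (Finset.mem_filter.1 hr₀).2
  set t := a r₀ / b r₀ with ht
  refine ⟨t, ⟨r₀, hb₀, by rw [ht]; field_simp; ring⟩, ?_⟩
  -- Up to the first breakpoint no term changes sign, so the sum is affine with the nonpositive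
  -- slope found at `0`.
  have hterm : ∀ r, |a r - t * b r| = |a r| - t * (SignType.sign (a r) * b r) := by
    intro r
    by_cases hr : b r = 0
    · simp [hr]
    have hkey : t * b r / a r ≤ 1 := by
      by_cases hrp : 0 < a r / b r
      · have h1 : t ≤ a r / b r := hmin r (Finset.mem_filter.2 ⟨Finset.mem_univ _, hr, hrp⟩)
        have h2 : t * b r / a r = t / (a r / b r) := by rw [div_div_eq_mul_div]
        rw [h2, div_le_one hrp]; exact h1
      · have h1 : b r / a r ≤ 0 := by
          rw [← inv_div]; exact inv_nonpos.2 (not_lt.1 hrp)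
        rw [mul_div_assoc]
        nlinarith
    rcases lt_or_gt_of_ne (h0 r hr) with ha | ha
    · rw [div_le_one_of_neg ha] at hkey
      rw [sign_neg ha, abs_of_neg ha, abs_of_nonpos (by linarith)]
      simp; ring
    · rw [div_le_one ha] at hkey
      rw [sign_pos ha, abs_of_pos ha, abs_of_nonneg (by linarith)]
      simp
  simp only [hterm, Finset.sum_sub_distrib, ← Finset.mul_sum]
  nlinarith

/-- The vectors supported on `T`. -/
def supportedOn {n : ℕ} (T : Finset (Fin n)) : Submodule ℝ (Fin n → ℝ) where
  carrier := {x | ∀ i, x i ≠ 0 → i ∈ T}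
  add_mem' := by
    intro x y hx hy i hi
    by_cases h : x i = 0
    · exact hy i (by simpa [h] using hi)
    · exact hx i h
  zero_mem' := by intro i hi; simp at hi
  smul_mem' := by
    intro c x hx i hi
    exact hx i (fun h => hi (by simp [h]))

/-- Induction on the number of nonzero residuals. If the zero residuals do not determine `w` in `V`,
some direction preserves them, and injectivity on `V` makes another residual vary; moving to a
breakpoint creates a new zero. No minimizer has to be known to exist beforehand. -/
theorem exists_vertex {n m : ℕ} (A : Matrix (Fin m) (Fin n) ℝ) (V : Submodule ℝ (Fin n → ℝ))
    (hA : ∀ v ∈ V, A.mulVec v = 0 → v = 0) (y : Fin m → ℝ) (w : Fin n → ℝ) (hw : w ∈ V) :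
    ∃ w' ∈ V, l1Norm (y - A.mulVec w') ≤ l1Norm (y - A.mulVec w) ∧
      ∀ v ∈ V, (∀ r, A.mulVec w' r = y r → A.mulVec v r = 0) → v = 0 := by
  classical
  induction hN : (Finset.univ.filter fun r => A.mulVec w r ≠ y r).card using
    Nat.strong_induction_on generalizing w with
  | _ N ih =>
  by_cases hdone : ∀ v ∈ V, (∀ r, A.mulVec w r = y r → A.mulVec v r = 0) → v = 0
  · exact ⟨w, hw, le_rfl, hdone⟩
  push Not at hdone
  obtain ⟨v, hv, hvZ, hv0⟩ := hdone
  obtain ⟨t, ⟨r₀, hb₀, hr₀⟩, hle⟩ := exists_breakpoint_sum_abs_le (y - A.mulVec w) (A.mulVec v)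
    (fun r hr h => hr (hvZ r (by simpa [sub_eq_zero, eq_comm] using h)))
    (by
      by_contra! h
      exact hv0 (hA v hv (funext h)))
  have hcalc : y - A.mulVec (w + t • v) = fun r => (y - A.mulVec w) r - t * A.mulVec v r := by
    funext r
    simp only [Matrix.mulVec_add, Matrix.mulVec_smul, Pi.sub_apply, Pi.add_apply, Pi.smul_apply,
      smul_eq_mul]
    ring
  have hlt : (Finset.univ.filter fun r => A.mulVec (w + t • v) r ≠ y r).card < N := by
    rw [← hN]
    refine Finset.card_lt_card (Finset.ssubset_iff_of_subset ?_ |>.2 ⟨r₀, ?_, ?_⟩)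
    · intro r hr
      simp only [Finset.mem_filter, Finset.mem_univ, true_and] at hr ⊢
      intro h
      apply hr
      simp [Matrix.mulVec_add, Matrix.mulVec_smul, h, hvZ r h]
    · simp only [Finset.mem_filter, Finset.mem_univ, true_and]
      exact fun h => hb₀ (hvZ r₀ h)
    · simp only [Finset.mem_filter, Finset.mem_univ, true_and, not_not]
      have := congrFun hcalc r₀
      rw [hr₀] at this
      simp only [Pi.sub_apply] at this
      linarith
  obtain ⟨w', hw', h1, h2⟩ := ih _ hlt (w + t • v) (V.add_mem hw (V.smul_mem t hv)) rfl
  refine ⟨w', hw', h1.trans ?_, h2⟩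
  rw [hcalc]
  exact hle

/-- The solution operator of the equations indexed by `R`, with solutions sought in `V`. -/
theorem exists_solution_operator {n m : ℕ} (A : Matrix (Fin m) (Fin n) ℝ)
    (V : Submodule ℝ (Fin n → ℝ)) (R : Finset (Fin m)) :
    ∃ L : Matrix (Fin n) (Fin m) ℝ, (∀ y, L.mulVec y ∈ V) ∧
      ((∀ v ∈ V, (∀ r ∈ R, A.mulVec v r = 0) → v = 0) →
        ∀ y, ∀ x ∈ V, (∀ r ∈ R, A.mulVec x r = y r) → L.mulVec y = x) := by
  by_cases hinj : ∀ v ∈ V, (∀ r ∈ R, A.mulVec v r = 0) → v = 0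
  swap
  -- For undetermined systems the zero operator serves as a default: its output still lies in `V`,
  -- so it remains a legitimate candidate.
  · exact ⟨0, fun y => by simp, fun h => absurd h hinj⟩
  let ρ : (Fin m → ℝ) →ₗ[ℝ] (R → ℝ) := LinearMap.funLeft ℝ ℝ (fun r : R => (r : Fin m))
  let φ : V →ₗ[ℝ] (R → ℝ) := ρ ∘ₗ A.mulVecLin ∘ₗ V.subtype
  have hφ : LinearMap.ker φ = ⊥ := by
    rw [LinearMap.ker_eq_bot']
    intro v hv
    apply Subtype.ext
    exact hinj v v.2 fun r hr => congrFun hv ⟨r, hr⟩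
  obtain ⟨ψ, hψ⟩ := LinearMap.exists_leftInverse_of_injective φ hφ
  refine ⟨LinearMap.toMatrix' (V.subtype ∘ₗ ψ ∘ₗ ρ), fun y => ?_, fun _ y x hx hxy => ?_⟩
  · rw [LinearMap.toMatrix'_mulVec]
    exact (ψ (ρ y)).2
  · rw [LinearMap.toMatrix'_mulVec]
    have h1 : ρ y = φ ⟨x, hx⟩ := by
      funext r
      exact (hxy r r.2).symm
    have h2 : ψ (φ ⟨x, hx⟩) = ⟨x, hx⟩ := by
      rw [← LinearMap.comp_apply, hψ]; rfl
    simp [h1, h2]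

/-- Finitely many linear maps, one of which solves the least absolute deviations problem. -/
theorem exists_linear_candidates {n m : ℕ} (A : Matrix (Fin m) (Fin n) ℝ)
    (M : Set (Finset (Fin n)))
    (hA : ∀ T ∈ M, ∀ v ∈ supportedOn T, A.mulVec v = 0 → v = 0) :
    ∃ l : List (Matrix (Fin n) (Fin m) ℝ), l.length ≤ 2 ^ n * 2 ^ m ∧
      (∀ L ∈ l, ∀ y, IsModelSparse M (L.mulVec y)) ∧
      ∀ y w, IsModelSparse M w → ∃ L ∈ l,
        l1Norm (y - A.mulVec (L.mulVec y)) ≤ l1Norm (y - A.mulVec w) := by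
  classical
  choose L hLV hL using fun p : Finset (Fin n) × Finset (Fin m) =>
    exists_solution_operator A (supportedOn p.1) p.2
  refine ⟨((M.toFinset ×ˢ Finset.univ).toList).map L, ?_, ?_, ?_⟩
  · rw [List.length_map, Finset.length_toList, Finset.card_product]
    gcongr
    · exact (Finset.card_le_univ _).trans (by simp)
    · simp
  · intro L' hL' y
    obtain ⟨p, hp, rfl⟩ := List.mem_map.1 hL'
    have : p.1 ∈ M := by simpa using hp
    exact ⟨p.1, this, hLV p y⟩
  · rintro y w ⟨T, hT, hw⟩
    obtain ⟨w', hw', hle, hv⟩ := exists_vertex A (supportedOn T) (hA T hT) y w hw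
    -- The vertex is recovered linearly from `y` once its support set and the rows with zero
    -- residual are known.
    refine ⟨_, List.mem_map.2 ⟨(T, Finset.univ.filter fun r => A.mulVec w' r = y r),
      by simpa using hT, rfl⟩, ?_⟩
    have hsol := hL (T, Finset.univ.filter fun r => A.mulVec w' r = y r)
      (fun v hvT h => hv v hvT fun r hr => h r (by simpa using hr)) y w' hw'
      (fun r hr => by simpa using hr)
    rw [hsol]
    exact hle

/-! ### Programs for computation trees -/

/-- The program `p`, a computation tree with a hole for its continuation, takes at most `c` steps
and transforms the register contents according to the relation `R`. -/
def Implements (p : CompTree → CompTree) (c : ℕ) (R : (ℕ → ℝ) → (ℕ → ℝ) → Prop) : Prop :=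
  ∀ t s, ∃ s', R s s' ∧ (p t).run s = t.run s' ∧ (p t).steps s ≤ t.steps s' + c

theorem Implements.comp {p q : CompTree → CompTree} {c d : ℕ} {R Q U : (ℕ → ℝ) → (ℕ → ℝ) → Prop}
    (hp : Implements p c R) (hq : Implements q d Q) (h : ∀ s s' s'', R s s' → Q s' s'' → U s s'') :
    Implements (fun t => p (q t)) (c + d) U := by
  intro t s
  obtain ⟨s', h1, h2, h3⟩ := hp (q t) s
  obtain ⟨s'', h4, h5, h6⟩ := hq t s'
  exact ⟨s'', h s s' s'' h1 h4, h2.trans h5, by simp only; omega⟩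

theorem implements_const (r : ℕ) (c : ℝ) :
    Implements (.const r c) 1 fun s s' => s' = Function.update s r c :=
  fun _ _ => ⟨_, rfl, rfl, le_rfl⟩

theorem implements_arith (o : ArithOp) (r i j : ℕ) :
    Implements (.arith o r i j) 1 fun s s' => s' = Function.update s r (o.apply (s i) (s j)) :=
  fun _ _ => ⟨_, rfl, rfl, le_rfl⟩

theorem exists_implements_add_mul {acc tmp j : ℕ} (c : ℝ) (h : tmp ≠ acc) (hj : j ≠ tmp) :
    ∃ p, Implements p 3 fun s s' => s' acc = s acc + c * s j ∧
      ∀ r, r ≠ tmp → r ≠ acc → s' r = s r := by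
  refine ⟨_, ((implements_const tmp c).comp (implements_arith .mul tmp tmp j)
    (fun _ _ _ h1 h2 => by subst h1; exact h2)).comp (implements_arith .add acc acc tmp) ?_⟩
  intro s s' s'' h1 h2
  subst h1 h2
  refine ⟨?_, fun r hr hr' => ?_⟩
  · simp [ArithOp.apply, h.symm, hj]
  · simp [hr, hr']

theorem exists_implements_add_abs {acc v tmp : ℕ} (hv : v ≠ tmp) (h : tmp ≠ acc) :
    ∃ p, Implements p 3 fun s s' => s' acc = s acc + |s v| ∧
      ∀ r, r ≠ tmp → r ≠ acc → s' r = s r := by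
  refine ⟨fun t => .const tmp 0 (.branch v tmp (.arith .sub acc acc v t) (.arith .add acc acc v t)),
    fun t s => ?_⟩
  by_cases hs : s v ≤ 0
  · refine ⟨_, ⟨?_, fun r hr hr' => ?_⟩, by
      simp only [CompTree.run, Function.update_self, Function.update_of_ne hv, if_pos hs]; rfl, by
      simp only [CompTree.steps, Function.update_self, Function.update_of_ne hv, if_pos hs]; rfl⟩
    · simp [ArithOp.apply, h.symm, abs_of_nonpos hs, sub_eq_add_neg]
    · simp [hr, hr']
  · refine ⟨_, ⟨?_, fun r hr hr' => ?_⟩, by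
      simp only [CompTree.run, Function.update_self, Function.update_of_ne hv, if_neg hs]; rfl, by
      simp only [CompTree.steps, Function.update_self, Function.update_of_ne hv, if_neg hs]; rfl⟩
    · simp [ArithOp.apply, h.symm, abs_of_pos (not_le.1 hs)]
    · simp [hr, hr']

/-- The data occupy the registers from `B` on and all scratch registers lie below `B`, so the data
survive every evaluation. -/
theorem exists_implements_dot {m B tmp acc : ℕ} (v : Fin m → ℝ) (htmp : tmp < B) (hacc : acc < B)
    (h : tmp ≠ acc) :
    ∃ p, Implements p (3 * m + 1) fun s s' => s' acc = ∑ j, v j * s (B + j) ∧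
      ∀ r, r ≠ tmp → r ≠ acc → s' r = s r := by
  suffices H : ∀ J : Finset (Fin m), ∃ p, Implements p (3 * J.card + 1) fun s s' =>
      s' acc = ∑ j ∈ J, v j * s (B + j) ∧ ∀ r, r ≠ tmp → r ≠ acc → s' r = s r by
    simpa using H Finset.univ
  intro J
  induction J using Finset.cons_induction with
  | empty =>
    refine ⟨.const acc 0, fun t s => ⟨Function.update s acc 0, ⟨by simp, fun r _ hr => ?_⟩,
      rfl, le_rfl⟩⟩
    simp [hr]
  | cons j J hj ih =>
    obtain ⟨p, hp⟩ := ih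
    obtain ⟨q, hq⟩ := exists_implements_add_mul (acc := acc) (tmp := tmp) (j := B + j) (v j) h
      (by omega)
    rw [Finset.card_cons, show 3 * (J.card + 1) + 1 = 3 * J.card + 1 + 3 by ring]
    refine ⟨_, hp.comp hq ?_⟩
    rintro s s' s'' ⟨h1, h2⟩ ⟨h3, h4⟩
    refine ⟨?_, fun r hr hr' => (h4 r hr hr').trans (h2 r hr hr')⟩
    rw [h3, h1, h2 (B + j) (by omega) (by omega), Finset.sum_cons, add_comm]

theorem exists_implements_l1Norm {m l B tmp acc obj : ℕ} (P : Matrix (Fin l) (Fin m) ℝ)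
    (htmp : tmp < B) (hacc : acc < B) (hobj : obj < B) (h1 : tmp ≠ acc) (h2 : tmp ≠ obj)
    (h3 : acc ≠ obj) :
    ∃ p, Implements p ((3 * m + 4) * l + 1) fun s s' =>
      s' obj = l1Norm (P.mulVec fun j => s (B + j)) ∧
      ∀ r, r ≠ tmp → r ≠ acc → r ≠ obj → s' r = s r := by
  suffices H : ∀ J : Finset (Fin l), ∃ p, Implements p ((3 * m + 4) * J.card + 1) fun s s' =>
      s' obj = ∑ i ∈ J, |∑ j, P i j * s (B + j)| ∧
      ∀ r, r ≠ tmp → r ≠ acc → r ≠ obj → s' r = s r by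
    simpa [l1Norm, Matrix.mulVec, dotProduct] using H Finset.univ
  intro J
  induction J using Finset.cons_induction with
  | empty =>
    refine ⟨.const obj 0, fun t s => ⟨Function.update s obj 0, ⟨by simp, fun r _ _ hr => ?_⟩,
      rfl, le_rfl⟩⟩
    simp [hr]
  | cons i J hi ih =>
    obtain ⟨p, hp⟩ := ih
    obtain ⟨q, hq⟩ := exists_implements_dot (B := B) (P i) htmp hacc h1
    obtain ⟨u, hu⟩ := exists_implements_add_abs (acc := obj) (v := acc) (tmp := tmp) h1.symm h2
    rw [Finset.card_cons, show (3 * m + 4) * (J.card + 1) + 1 =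
      (3 * m + 4) * J.card + 1 + (3 * m + 1 + 3) by ring]
    refine ⟨_, hp.comp (hq.comp hu (U := fun s s'' => ∃ s', _ ∧ _)
      fun s s' s'' a b => ⟨s', a, b⟩) ?_⟩
    rintro s s₁ s₃ ⟨a1, a2⟩ ⟨s₂, ⟨b1, b2⟩, c1, c2⟩
    refine ⟨?_, fun r hr hr' hr'' =>
      (c2 r hr hr'').trans ((b2 r hr hr').trans (a2 r hr hr' hr''))⟩
    rw [c1, b1, b2 obj h2.symm h3.symm, a1, Finset.sum_cons, add_comm]
    congr 2
    refine Finset.sum_congr rfl fun j _ => ?_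
    rw [a2 (B + j) (by omega) (by omega) (by omega)]

theorem exists_implements_mulVec {m n B tmp : ℕ} (L : Matrix (Fin n) (Fin m) ℝ)
    (hn : n ≤ tmp) (htmp : tmp < B) :
    ∃ p, Implements p ((3 * m + 1) * n) fun s s' =>
      ∀ i : Fin n, s' i = L.mulVec (fun j => s (B + j)) i := by
  suffices H : ∀ J : Finset (Fin n), ∃ p, Implements p ((3 * m + 1) * J.card) fun s s' =>
      (∀ i ∈ J, s' i = ∑ j, L i j * s (B + j)) ∧ ∀ r, tmp < r → s' r = s r by
    obtain ⟨p, hp⟩ := H Finset.univ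
    rw [Finset.card_univ, Fintype.card_fin] at hp
    refine ⟨p, fun t s => ?_⟩
    obtain ⟨s', ⟨h1, -⟩, h2⟩ := hp t s
    exact ⟨s', fun i => h1 i (Finset.mem_univ i), h2⟩
  intro J
  induction J using Finset.cons_induction with
  | empty => exact ⟨id, fun t s => ⟨s, by simp, rfl, by simp⟩⟩
  | cons i J hi ih =>
    obtain ⟨p, hp⟩ := ih
    obtain ⟨q, hq⟩ := exists_implements_dot (B := B) (tmp := tmp) (acc := i) (L i) htmp
      (by omega) (by omega)
    rw [Finset.card_cons, mul_add, mul_one]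
    refine ⟨_, hp.comp hq ?_⟩
    rintro s s' s'' ⟨a1, a2⟩ ⟨b1, b2⟩
    refine ⟨fun i' hi' => ?_, fun r hr => (b2 r (by omega) (by omega)).trans (a2 r hr)⟩
    rcases Finset.mem_cons.1 hi' with rfl | hmem
    · rw [b1]
      refine Finset.sum_congr rfl fun j _ => ?_
      rw [a2 (B + j) (by omega)]
    · have hne : i' ≠ i := fun h => hi (h ▸ hmem)
      rw [b2 i' (by omega) (fun h => hne (Fin.ext h)), a1 i' hmem]

/-- Input and output share the lowest registers, so the input is moved out of the way first. A copy
is an addition of the zero kept in `tmp`. -/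
theorem exists_implements_copy {m B tmp : ℕ} (hm : m ≤ tmp) (htmp : tmp < B) :
    ∃ p, Implements p (m + 1) fun s s' => ∀ j : Fin m, s' (B + j) = s j := by
  suffices H : ∀ J : Finset (Fin m), ∃ p, Implements p (J.card + 1) fun s s' =>
      (∀ j ∈ J, s' (B + j) = s j) ∧ s' tmp = 0 ∧ ∀ r, r < tmp → s' r = s r by
    obtain ⟨p, hp⟩ := H Finset.univ
    rw [Finset.card_univ, Fintype.card_fin] at hp
    refine ⟨p, fun t s => ?_⟩
    obtain ⟨s', ⟨h1, -⟩, h2⟩ := hp t s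
    exact ⟨s', fun i => h1 i (Finset.mem_univ i), h2⟩
  intro J
  induction J using Finset.cons_induction with
  | empty =>
    refine ⟨.const tmp 0, fun t s => ⟨Function.update s tmp 0, ⟨by simp, by simp, fun r hr => ?_⟩,
      rfl, le_rfl⟩⟩
    simp [hr.ne]
  | cons j J hj ih =>
    obtain ⟨p, hp⟩ := ih
    rw [Finset.card_cons]
    refine ⟨_, hp.comp (implements_arith .add (B + j) j tmp) ?_⟩
    rintro s s' s'' ⟨a1, a2, a3⟩ rfl
    refine ⟨fun j' hj' => ?_, ?_, fun r hr => ?_⟩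
    · rcases Finset.mem_cons.1 hj' with rfl | hmem
      · simp [ArithOp.apply, a2, a3 j' (by omega)]
      · have hne : (j' : ℕ) ≠ j := fun h => hj (Fin.ext h ▸ hmem)
        rw [Function.update_of_ne (by omega), a1 j' hmem]
    · rw [Function.update_of_ne (by omega), a2]
    · rw [Function.update_of_ne (by omega), a3 r hr]

/-- Selection of the best one among finitely many linear candidates; the register `u + 3` holds
the objective value of the current best candidate `L₀`. -/
theorem exists_select {n m u : ℕ} (hu : n ≤ u) (A : Matrix (Fin m) (Fin n) ℝ)
    (l : List (Matrix (Fin n) (Fin m) ℝ)) (L₀ : Matrix (Fin n) (Fin m) ℝ) :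
    ∃ t : CompTree, ∀ (s : ℕ → ℝ) (y : Fin m → ℝ), (∀ j : Fin m, s (u + 4 + j) = y j) →
      s (u + 3) = l1Norm (y - A.mulVec (L₀.mulVec y)) →
      t.steps s ≤ l.length * ((3 * m + 4) * m + 4) + (3 * m + 1) * n ∧
      ∃ L ∈ L₀ :: l, (∀ i : Fin n, t.run s i = L.mulVec y i) ∧
        ∀ L' ∈ L₀ :: l,
          l1Norm (y - A.mulVec (L.mulVec y)) ≤ l1Norm (y - A.mulVec (L'.mulVec y)) := by
  induction l generalizing L₀ with
  | nil =>
    obtain ⟨p, hp⟩ := exists_implements_mulVec (B := u + 4) (tmp := u) L₀ hu (by omega)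
    refine ⟨p .halt, fun s y hy _ => ?_⟩
    obtain ⟨s', h1, h2, h3⟩ := hp .halt s
    refine ⟨by simpa [CompTree.steps] using h3, L₀, by simp, fun i => ?_, by simp⟩
    rw [h2, CompTree.run, h1 i]
    simp only [hy]
  | cons L₁ l ih =>
    obtain ⟨t₀, ht₀⟩ := ih L₀
    obtain ⟨t₁, ht₁⟩ := ih L₁
    obtain ⟨p, hp⟩ := exists_implements_l1Norm (B := u + 4) (tmp := u) (acc := u + 1)
      (obj := u + 2) (1 - A * L₁) (by omega) (by omega) (by omega) (by omega) (by omega) (by omega)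
    -- The identity of the current best candidate is not stored: the branch taken encodes it, with a
    -- separate continuation for each outcome.
    refine ⟨p (.branch (u + 2) (u + 3) (.const u 0 (.arith .add (u + 3) (u + 2) u t₁)) t₀),
      fun s y hy hs => ?_⟩
    obtain ⟨s', ⟨h1, h2⟩, h3, h4⟩ := hp
      (.branch (u + 2) (u + 3) (.const u 0 (.arith .add (u + 3) (u + 2) u t₁)) t₀) s
    have hy' : ∀ j : Fin m, s' (u + 4 + j) = y j := fun j => by
      rw [h2 _ (by omega) (by omega) (by omega), hy]
    have hs' : s' (u + 3) = l1Norm (y - A.mulVec (L₀.mulVec y)) := by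
      rw [h2 _ (by omega) (by omega) (by omega), hs]
    have hcur : s' (u + 2) = l1Norm (y - A.mulVec (L₁.mulVec y)) := by
      rw [h1]
      simp only [hy, Matrix.sub_mulVec, Matrix.one_mulVec, Matrix.mulVec_mulVec]
    rw [List.length_cons, add_mul, one_mul, h3]
    by_cases hc : s' (u + 2) ≤ s' (u + 3)
    · simp only [CompTree.run, CompTree.steps, if_pos hc] at h4 ⊢
      set s'' := Function.update (Function.update s' u 0) (u + 3)
        (ArithOp.apply .add (Function.update s' u 0 (u + 2)) (Function.update s' u 0 u)) with hs''
      have e1 : ∀ j : Fin m, s'' (u + 4 + j) = y j := fun j => by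
        rw [hs'', Function.update_of_ne (by omega), Function.update_of_ne (by omega), hy']
      have e2 : s'' (u + 3) = l1Norm (y - A.mulVec (L₁.mulVec y)) := by
        rw [hs'', Function.update_self]
        simp [ArithOp.apply, hcur]
      obtain ⟨k1, L, hL, k2, k3⟩ := ht₁ s'' y e1 e2
      refine ⟨by omega, L, List.mem_cons_of_mem _ hL, k2, fun L' hL' => ?_⟩
      rcases List.mem_cons.1 hL' with rfl | hL'
      · refine (k3 L₁ List.mem_cons_self).trans ?_
        rwa [← hcur, ← hs']
      · exact k3 L' hL'
    · simp only [CompTree.run, CompTree.steps, if_neg hc] at h4 ⊢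
      obtain ⟨k1, L, hL, k2, k3⟩ := ht₀ s' y hy' hs'
      refine ⟨by omega, L, ?_, k2, fun L' hL' => ?_⟩
      · rcases List.mem_cons.1 hL with rfl | hL
        · exact List.mem_cons_self
        · exact List.mem_cons_of_mem _ (List.mem_cons_of_mem _ hL)
      · rcases List.mem_cons.1 hL' with rfl | hL'
        · exact k3 _ List.mem_cons_self
        rcases List.mem_cons.1 hL' with rfl | hL'
        · refine (k3 L₀ List.mem_cons_self).trans ?_
          rw [← hcur, ← hs']
          exact (not_le.1 hc).le
        · exact k3 L' (List.mem_cons_of_mem _ hL')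

theorem exists_compTree_select {n m : ℕ} (A : Matrix (Fin m) (Fin n) ℝ)
    (l : List (Matrix (Fin n) (Fin m) ℝ)) (hl : l ≠ []) :
    ∃ t : CompTree, ∀ y : Fin m → ℝ,
      t.steps (inputRegisters y) ≤
        (m + 1) + l.length * ((3 * m + 4) * m + 4) + (3 * m + 1) * n ∧
      ∃ L ∈ l, t.decode n y = L.mulVec y ∧
        ∀ L' ∈ l,
          l1Norm (y - A.mulVec (L.mulVec y)) ≤ l1Norm (y - A.mulVec (L'.mulVec y)) := by
  obtain ⟨L₀, l, rfl⟩ := List.exists_cons_of_ne_nil hl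
  set u := n + m with hu
  obtain ⟨t, ht⟩ := exists_select (u := u) (by omega) A l L₀
  obtain ⟨p, hp⟩ := exists_implements_copy (m := m) (B := u + 4) (tmp := u) (by omega) (by omega)
  obtain ⟨q, hq⟩ := exists_implements_l1Norm (B := u + 4) (tmp := u) (acc := u + 1)
    (obj := u + 3) (1 - A * L₀) (by omega) (by omega) (by omega) (by omega) (by omega) (by omega)
  refine ⟨p (q t), fun y => ?_⟩
  obtain ⟨s₁, a1, a2, a3⟩ := hp (q t) (inputRegisters y)
  obtain ⟨s₂, ⟨b1, b2⟩, b3, b4⟩ := hq t s₁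
  have hy₁ : ∀ j : Fin m, s₁ (u + 4 + j) = y j := fun j => by
    rw [a1 j]; simp [inputRegisters]
  obtain ⟨k1, L, hL, k2, k3⟩ := ht s₂ y
    (fun j => by rw [b2 _ (by omega) (by omega) (by omega), hy₁])
    (by rw [b1]; simp only [hy₁, Matrix.sub_mulVec, Matrix.one_mulVec, Matrix.mulVec_mulVec])
  refine ⟨?_, L, hL, ?_, k3⟩
  · rw [List.length_cons, add_mul, one_mul]
    omega
  · funext i
    rw [CompTree.decode, a2, b3, k2]

/-! ### From the isometry property to recovery -/

theorem select_steps_le {m n N : ℕ} (hn : 1 ≤ n) (hm : m ≤ n) (hN : N ≤ 2 ^ n * 2 ^ m) :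
    (m + 1) + N * ((3 * m + 4) * m + 4) + (3 * m + 1) * n ≤ 2 ^ (9 * n) := by
  have h2 : n ≤ 2 ^ n := Nat.lt_two_pow_self.le
  have h1 : 1 ≤ 2 ^ n := Nat.one_le_two_pow
  have h3 : N ≤ 2 ^ n * 2 ^ n :=
    hN.trans (Nat.mul_le_mul_left _ (Nat.pow_le_pow_right (by norm_num) hm))
  -- The cost is at most `2 ^ 5 * (2 ^ n) ^ 4`; as `n ≥ 1`, the constant is absorbed by five more
  -- factors `2 ^ n`, which gives the exponent `9n`.
  have h4 : 2 ^ 5 ≤ (2 ^ n) ^ 5 := by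
    gcongr
    calc 2 = 2 ^ 1 := rfl
      _ ≤ 2 ^ n := Nat.pow_le_pow_right (by norm_num) hn
  have h5 : 2 ^ (9 * n) = (2 ^ n) ^ 5 * (2 ^ n) ^ 4 := by
    rw [← pow_add, ← pow_mul, mul_comm]
  rw [h5]
  set x := 2 ^ n
  have hmx : m ≤ x := hm.trans h2
  have a1 : (3 * m + 4) * m + 4 ≤ 11 * (x * x) := by nlinarith
  have a2 : N * ((3 * m + 4) * m + 4) ≤ 11 * ((x * x) * (x * x)) :=
    (Nat.mul_le_mul h3 a1).trans_eq (by ring)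
  have a3 : (3 * m + 1) * n ≤ 4 * (x * x) := by nlinarith
  have a4 : x * x ≤ (x * x) * (x * x) := Nat.le_mul_of_pos_right _ (by positivity)
  have a5 : x ≤ x * x := Nat.le_mul_of_pos_right _ (by positivity)
  calc (m + 1) + N * ((3 * m + 4) * m + 4) + (3 * m + 1) * n ≤ 2 ^ 5 * x ^ 4 := by
        have : x ^ 4 = (x * x) * (x * x) := by ring
        rw [this]
        generalize (x * x) * (x * x) = z at *
        generalize x * x = w at *
        omega
    _ ≤ _ := by gcongr

/-- The decoded `z` fits `Ax` at least as well as `x'`, so `‖A(x' - z)‖₁ ≤ 2‖x - x'‖₁`. The lower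
isometry bound applies to `x' - z`, supported on two model sets; the tail `x - x'` needs only the
upper bound. -/
theorem stableRecovery_of_l1_isometry {n m : ℕ} (hn : 1 ≤ n) (hm : m ≤ n)
    (M : Set (Finset (Fin n))) (A : Matrix (Fin m) (Fin n) ℝ) (α : ℝ) (hα : 0 < α)
    (hlow : ∀ T₁ ∈ M, ∀ T₂ ∈ M, ∀ z : Fin n → ℝ, (∀ i, z i ≠ 0 → i ∈ T₁ ∪ T₂) →
      α * l1Norm z ≤ l1Norm (A.mulVec z))
    (hup : ∀ z, l1Norm (A.mulVec z) ≤ l1Norm z) :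
    StableRecovery M m (1 + 2 / α) (2 ^ (9 * n)) := by
  have hinj : ∀ T ∈ M, ∀ v ∈ supportedOn T, A.mulVec v = 0 → v = 0 := by
    intro T hT v hv h
    have h1 := hlow T hT T hT v fun i hi => Finset.mem_union_left _ (hv i hi)
    rw [h] at h1
    have h2 : l1Norm (0 : Fin m → ℝ) = 0 := by simp [l1Norm]
    rw [h2] at h1
    exact eq_zero_of_l1Norm_le_zero (nonpos_of_mul_nonpos_right h1 hα)
  obtain ⟨l, hlen, hsparse, hopt⟩ := exists_linear_candidates A M hinj
  rcases eq_or_ne l [] with rfl | hl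
  -- With no candidates there are no model-sparse vectors, and the guarantee is vacuous.
  · refine ⟨A, .halt, fun y => by simp [CompTree.steps], fun x x' hx' => ?_⟩
    obtain ⟨L, hL, -⟩ := hopt 0 x' hx'
    simp at hL
  obtain ⟨t, ht⟩ := exists_compTree_select A l hl
  refine ⟨A, t, fun y => (ht y).1.trans (select_steps_le hn hm hlen), fun x x' hx' => ?_⟩
  obtain ⟨-, L, hL, hdec, hbest⟩ := ht (A.mulVec x)
  obtain ⟨L', hL', hle⟩ := hopt (A.mulVec x) x' hx'
  rw [hdec]
  set z := L.mulVec (A.mulVec x)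
  obtain ⟨T₁, hT₁, hz⟩ : IsModelSparse M z := hsparse L hL _
  obtain ⟨T₂, hT₂, hx⟩ := hx'
  have h1 : l1Norm (A.mulVec x - A.mulVec z) ≤ l1Norm (x - x') := by
    refine ((hbest L' hL').trans hle).trans ?_
    rw [← Matrix.mulVec_sub]
    exact hup _
  have h2 : α * l1Norm (x' - z) ≤ l1Norm (A.mulVec (x' - z)) := by
    refine hlow T₁ hT₁ T₂ hT₂ _ fun i hi => ?_
    by_contra hni
    rw [Finset.mem_union, not_or] at hni
    have e1 : z i = 0 := by
      by_contra h
      exact hni.1 (hz i h)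
    have e2 : x' i = 0 := by
      by_contra h
      exact hni.2 (hx i h)
    simp [e1, e2] at hi
  have h3 : l1Norm (A.mulVec (x' - z)) ≤ 2 * l1Norm (x - x') := by
    have e : A.mulVec (x' - z) = (A.mulVec x - A.mulVec z) + -(A.mulVec (x - x')) := by
      rw [Matrix.mulVec_sub, Matrix.mulVec_sub]
      abel
    rw [e]
    refine (l1Norm_add_le _ _).trans ?_
    rw [l1Norm_neg]
    linarith [hup (x - x')]
  have h4 : l1Norm (x' - z) ≤ 2 / α * l1Norm (x - x') := by
    rw [div_mul_eq_mul_div, le_div_iff₀ hα]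
    linarith
  have h5 := l1Norm_add_le (x - x') (x' - z)
  rw [sub_add_sub_cancel] at h5
  linarith

theorem StableRecovery.mono {n m T : ℕ} {M : Set (Finset (Fin n))} {F F' : ℝ} (hF : F ≤ F')
    (h : StableRecovery M m F T) : StableRecovery M m F' T := by
  obtain ⟨A, t, h1, h2⟩ := h
  exact ⟨A, t, h1, fun x x' hx' => (h2 x x' hx').trans
    (mul_le_mul_of_nonneg_right hF (l1Norm_nonneg _))⟩

theorem stableRecovery_self {n : ℕ} (M : Set (Finset (Fin n))) {F : ℝ} (hF : 0 ≤ F) (T : ℕ) :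
    StableRecovery M n F T := by
  refine ⟨1, .halt, fun y => by simp [CompTree.steps], fun x x' _ => ?_⟩
  have : CompTree.halt.decode n ((1 : Matrix (Fin n) (Fin n) ℝ).mulVec x) = x := by
    funext i
    simp [CompTree.decode, CompTree.run, inputRegisters]
  rw [this, sub_self]
  have h0 : l1Norm (0 : Fin n → ℝ) = 0 := by simp [l1Norm]
  rw [h0]
  exact mul_nonneg hF (l1Norm_nonneg _)

/-- Recovery for a model whose size is controlled at every scale `s` at which there are too many
sets of that size altogether. -/
theorem exists_stableRecovery {n k : ℕ} (M : Set (Finset (Fin n))) (ε Λ : ℝ) (hε : 0 < ε)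
    (hε1 : ε < 1 / 2) (hk : 1 ≤ k) (hkn : k ≤ n) (hM : ∀ T ∈ M, T.card ≤ k) (hΛ : 1 ≤ Λ)
    (hcount : ∀ s : ℕ, 1 ≤ s → s ≤ 2 * k →
      (n / k : ℝ) ≤ (12 * k / s : ℝ) ^ Λ ∨ (M.ncard : ℝ) ≤ (12 * k / s : ℝ) ^ (2 * Λ * s)) :
    ∃ m : ℕ, (m : ℝ) ≤ 1000 / ε ^ 2 * (k * Λ) ∧
      StableRecovery M m (3 + 4 * ε) (2 ^ (9 * n)) := by
  have he := Real.exp_pos 1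
  have he3 : Real.exp 1 < 3 := Real.exp_one_lt_three
  have hk' : (1 : ℝ) ≤ k := by exact_mod_cast hk
  set η := ε / 2 with hη
  have hη0 : 0 < η := by positivity
  set d := ⌈5 * Λ / η⌉₊ with hd
  set m := ⌈12 * Real.exp 1 * d * k / η⌉₊ with hm
  have hd1 : 5 * Λ / η ≤ d := Nat.le_ceil _
  have hΛη : 1 ≤ Λ / η := by rw [le_div_iff₀ hη0]; linarith
  have hd2 : (d : ℝ) ≤ 6 * (Λ / η) := by
    have := (Nat.ceil_lt_add_one (show 0 ≤ 5 * Λ / η by positivity)).le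
    rw [mul_div_assoc] at this
    rw [hd, mul_div_assoc]
    linarith
  have hd0 : (1 : ℝ) ≤ d := by
    refine le_trans ?_ hd1
    rw [mul_div_assoc]
    linarith
  have hm1 : 12 * Real.exp 1 * d * k / η ≤ m := Nat.le_ceil _
  have hdk : 1 ≤ d * k / η := by
    rw [le_div_iff₀ hη0]
    nlinarith
  have hm2 : (m : ℝ) ≤ 1000 / ε ^ 2 * (k * Λ) := by
    have h1 : (m : ℝ) ≤ 12 * Real.exp 1 * d * k / η + 1 :=
      (Nat.ceil_lt_add_one (by positivity)).le
    have h2 : 12 * Real.exp 1 * d * k / η = 12 * Real.exp 1 * (d * k / η) := by ring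
    have h3 : 12 * Real.exp 1 * (d * k / η) ≤ 36 * (d * k / η) := by
      gcongr
      linarith
    calc (m : ℝ) ≤ 37 * (d * k / η) := by linarith
      _ ≤ 37 * (6 * (Λ / η) * k / η) := by gcongr
      _ = 888 / ε ^ 2 * (k * Λ) := by rw [hη]; field_simp; ring
      _ ≤ _ := by gcongr; norm_num
  -- If the formula for `m` exceeds `n`, measuring `x` itself is cheaper; otherwise `m ≤ n` keeps
  -- the search within `2 ^ (9n)` steps.
  by_cases hmn : m ≤ n
  swap
  · refine ⟨n, le_trans ?_ hm2, stableRecovery_self M (by positivity) _⟩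
    exact_mod_cast (not_le.1 hmn).le
  refine ⟨m, hm2, ?_⟩
  obtain ⟨f, hf⟩ := exists_isModelExpander (d := d) (m := m) M η Λ hη0 (by linarith) hk hM hΛ
    (by rwa [div_le_iff₀' hη0] at hd1) (by rwa [div_le_iff₀' hη0] at hm1) hcount
  have hdpos : 0 < d := by exact_mod_cast lt_of_lt_of_le one_pos hd0
  have hrec := stableRecovery_of_l1_isometry (hk.trans hkn) hmn M (adjacencyMatrix f) (1 - 2 * η)
    (by rw [hη]; linarith)
    (fun T₁ h₁ T₂ h₂ z hz => one_sub_mul_l1Norm_le hdpos f η (T₁ ∪ T₂) (hf T₁ h₁ T₂ h₂) z hz)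
    (l1Norm_adjacencyMatrix_mulVec_le hdpos f)
  refine hrec.mono ?_
  -- Here `1 - 2η = 1 - ε`, and the inequality amounts to `4ε² ≤ 2ε`, that is, `ε ≤ 1/2`.
  have h1 : 2 / (1 - 2 * η) ≤ 2 + 4 * ε := by
    rw [hη, div_le_iff₀ (by linarith)]
    nlinarith
  linarith

/-! ### The sizes of the two models -/

theorem card_le_of_mem_blockModel {n k b : ℕ} (hb : b ∣ k) (β : Fin n → Fin (n / b))
    (hβ : IsBlockPartition b β) : ∀ T ∈ blockModel k b β, T.card ≤ k := by
  rintro T ⟨J, hJ, rfl⟩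
  have : (Finset.univ.filter fun i => β i ∈ J) =
      J.biUnion fun j => Finset.univ.filter fun i => β i = j := by
    ext i; simp
  rw [this]
  refine (Finset.card_biUnion_le_card_mul J _ b fun j _ => (hβ j).le).trans ?_
  rw [hJ, Nat.div_mul_cancel hb]

theorem ncard_blockModel_le {n : ℕ} (k b : ℕ) (β : Fin n → Fin (n / b)) :
    (blockModel k b β).ncard ≤ (n / b).choose (k / b) := by
  classical
  have hsub : blockModel k b β ⊆ ((Finset.univ.powersetCard (k / b)).image fun J =>
      Finset.univ.filter fun i => β i ∈ J : Finset (Finset (Fin n))) := by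
    rintro S ⟨J, hJ, rfl⟩
    simp only [Finset.coe_image, Set.mem_image, Finset.mem_coe, Finset.mem_powersetCard]
    exact ⟨J, ⟨Finset.subset_univ _, hJ⟩, rfl⟩
  refine (Set.ncard_le_ncard hsub (Finset.finite_toSet _)).trans ?_
  rw [Set.ncard_coe_finset]
  refine Finset.card_image_le.trans ?_
  simp

/-- The number of elements of `S` below `x`. -/
def rankIn {n : ℕ} (S : Finset (Fin n)) (x : ℕ) : ℕ := (S.filter fun c : Fin n => (c : ℕ) < x).card

/-- The code of a subtree: each vertex but the root contributes the rank of its parent in the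
subtree, together with the side on which it hangs. -/
def treeCode {n : ℕ} (S : Finset (Fin n)) : Finset ℕ :=
  (S.filter fun c : Fin n => 0 < (c : ℕ)).image fun c : Fin n =>
    2 * rankIn S (((c : ℕ) - 1) / 2) + ((c : ℕ) - 1) % 2

theorem rankIn_lt_rankIn {n : ℕ} {S : Finset (Fin n)} {p : Fin n} (hp : p ∈ S) {x : ℕ}
    (h : (p : ℕ) < x) : rankIn S p < rankIn S x := by
  refine Finset.card_lt_card (Finset.ssubset_iff_of_subset ?_ |>.2 ⟨p, by simp [hp, h], by simp⟩)
  intro c hc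
  simp only [Finset.mem_filter] at hc ⊢
  exact ⟨hc.1, by omega⟩

theorem rankIn_injOn {n : ℕ} {S : Finset (Fin n)} {p q : Fin n} (hp : p ∈ S) (hq : q ∈ S)
    (h : rankIn S p = rankIn S q) : p = q := by
  rcases lt_trichotomy (p : ℕ) q with hlt | heq | hlt
  · exact absurd h (rankIn_lt_rankIn hp hlt).ne
  · exact Fin.ext heq
  · exact absurd h (rankIn_lt_rankIn hq hlt).ne'

theorem parent_mem {n k : ℕ} {S : Finset (Fin n)} (hS : S ∈ treeModel n k) {c : Fin n}
    (hc : c ∈ S) (h0 : 0 < (c : ℕ)) : (⟨((c : ℕ) - 1) / 2, by omega⟩ : Fin n) ∈ S := by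
  refine hS.2.2 _ c ?_ hc
  simp only [IsTreeParent]
  omega

/-- A parent in the subtree has rank at most `k - 1`, and the side adds `0` or `1`. -/
theorem treeCode_subset_range {n k : ℕ} {S : Finset (Fin n)} (hS : S ∈ treeModel n k) :
    treeCode S ⊆ Finset.range (2 * k) := by
  intro v hv
  obtain ⟨c, hc, rfl⟩ := Finset.mem_image.1 hv
  obtain ⟨hcS, hc0⟩ := Finset.mem_filter.1 hc
  have h1 := rankIn_lt_rankIn (parent_mem hS hcS hc0) (x := n) (by simp only; omega)
  have h2 : rankIn S n ≤ k := by
    rw [← hS.1]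
    exact Finset.card_le_card (Finset.filter_subset _ _)
  simp only at h1
  rw [Finset.mem_range]
  omega

/-- Decoding in level order: agreement below `x` fixes the rank of its parent in both subtrees. The
code word of `x` then comes from a vertex of `S'` with the same parent and side, which is `x`. -/
theorem mem_of_treeCode_eq {n k : ℕ} {S S' : Finset (Fin n)} (hS : S ∈ treeModel n k)
    (hS' : S' ∈ treeModel n k) (h : treeCode S = treeCode S') {x : Fin n}
    (ih : ∀ y : Fin n, (y : ℕ) < x → (y ∈ S ↔ y ∈ S')) (hx : x ∈ S) : x ∈ S' := by
  rcases Nat.eq_zero_or_pos (x : ℕ) with h0 | h0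
  · obtain ⟨r, hr, hr0⟩ := hS'.2.1
    rwa [show x = r from Fin.ext (h0.trans hr0.symm)]
  have hp := parent_mem hS hx h0
  have hp' := (ih _ (by simp only; omega)).1 hp
  have hrank : rankIn S (((x : ℕ) - 1) / 2) = rankIn S' (((x : ℕ) - 1) / 2) := by
    unfold rankIn
    congr 1
    ext c
    simp only [Finset.mem_filter]
    constructor
    · rintro ⟨a, b⟩
      exact ⟨(ih c (by omega)).1 a, b⟩
    · rintro ⟨a, b⟩
      exact ⟨(ih c (by omega)).2 a, b⟩
  have hmem : 2 * rankIn S (((x : ℕ) - 1) / 2) + ((x : ℕ) - 1) % 2 ∈ treeCode S' := by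
    rw [← h]
    exact Finset.mem_image.2 ⟨x, Finset.mem_filter.2 ⟨hx, h0⟩, rfl⟩
  obtain ⟨c, hc, hcx⟩ := Finset.mem_image.1 hmem
  obtain ⟨hcS, hc0⟩ := Finset.mem_filter.1 hc
  have heq := rankIn_injOn (parent_mem hS' hcS hc0) hp' (by simp only; omega)
  have heq' : ((c : ℕ) - 1) / 2 = ((x : ℕ) - 1) / 2 := congrArg Fin.val heq
  rwa [show x = c from Fin.ext (by rw [hrank, heq'] at hcx; omega)]

theorem treeCode_injOn (n k : ℕ) : Set.InjOn treeCode (treeModel n k) := by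
  intro S hS S' hS' h
  have H : ∀ x : ℕ, ∀ hx : x < n, (⟨x, hx⟩ : Fin n) ∈ S ↔ (⟨x, hx⟩ : Fin n) ∈ S' := by
    intro x
    induction x using Nat.strong_induction_on with
    | _ x ih =>
      intro hx
      exact ⟨mem_of_treeCode_eq hS hS' h fun y hy => ih y hy y.2,
        mem_of_treeCode_eq hS' hS h.symm fun y hy => (ih y hy y.2).symm⟩
  ext x
  exact H x x.2

theorem ncard_treeModel_le (n k : ℕ) : (treeModel n k).ncard ≤ 4 ^ k := by
  have h := Set.ncard_le_ncard_of_injOn (s := treeModel n k)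
    (t := ((Finset.range (2 * k)).powerset : Set (Finset ℕ))) treeCode
    (fun S hS => Finset.mem_coe.2 (Finset.mem_powerset.2 (treeCode_subset_range hS)))
    (treeCode_injOn n k)
    (Finset.finite_toSet _)
  rw [Set.ncard_coe_finset, Finset.card_powerset, Finset.card_range, pow_mul] at h
  exact h

/-! ### The two numerical conditions -/

/-- `log x / x` decreases for `x ≥ e`, and `12u ≥ 6`. This reduces all scales `u = k/s` below the
crossover `B` to the crossover itself. -/
theorem log_twelve_mul_le {u B : ℝ} (hu : 1 / 2 ≤ u) (huB : u ≤ B) :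
    u * (Real.log (12 * B) / B) ≤ Real.log (12 * u) := by
  have he3 : Real.exp 1 < 3 := Real.exp_one_lt_three
  have h := Real.log_div_self_antitoneOn (show 12 * u ∈ {x | Real.exp 1 ≤ x} from
    show Real.exp 1 ≤ 12 * u by linarith) (show 12 * B ∈ {x | Real.exp 1 ≤ x} from
    show Real.exp 1 ≤ 12 * B by linarith) (by linarith : 12 * u ≤ 12 * B)
  simp only at h
  rw [le_div_iff₀ (by linarith)] at h
  have hB : B ≠ 0 := by linarith
  calc u * (Real.log (12 * B) / B) = Real.log (12 * B) / (12 * B) * (12 * u) := by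
        field_simp
    _ ≤ _ := h

/-- Write `ρ = n/k` and `u = k/s`. For `u ≥ b`, `b ^ logb b ρ = ρ` gives the first alternative. For
`u ≤ b`, the model has at most `(eρ) ^ (k/b)` sets, and after taking logarithms the worst case is `u
= b`. -/
theorem block_count {n k b : ℕ} (hk : 1 ≤ k) (hkn : k ≤ n) (hb : 2 ≤ b) (hbk : b ∣ k)
    (hbn : b ∣ n) (N : ℕ) (hN : N ≤ (n / b).choose (k / b)) (s : ℕ) (hs : 1 ≤ s)
    (hsk : s ≤ 2 * k) :
    (n / k : ℝ) ≤ (12 * k / s : ℝ) ^ (1 + Real.logb b (n / k)) ∨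
      (N : ℝ) ≤ (12 * k / s : ℝ) ^ (2 * (1 + Real.logb b (n / k)) * s) := by
  have hk' : (1 : ℝ) ≤ k := by exact_mod_cast hk
  have hb' : (2 : ℝ) ≤ b := by exact_mod_cast hb
  have hs' : (1 : ℝ) ≤ s := by exact_mod_cast hs
  have hsk' : (s : ℝ) ≤ 2 * k := by exact_mod_cast hsk
  have hkn' : (k : ℝ) ≤ n := by exact_mod_cast hkn
  have hρ : (1 : ℝ) ≤ n / k := by rw [le_div_iff₀ (by linarith)]; linarith
  set ρ : ℝ := n / k
  have hlogb : 0 ≤ Real.logb b ρ := Real.logb_nonneg (by linarith) hρ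
  set u : ℝ := k / s with hu
  have hu12 : 1 / 2 ≤ u := by rw [hu, div_le_div_iff₀ (by norm_num) (by linarith)]; linarith
  rw [mul_div_assoc]
  rcases le_total (b : ℝ) u with hbu | hbu
  · left
    calc ρ = (b : ℝ) ^ Real.logb b ρ :=
          (Real.rpow_logb (by linarith) (by linarith) (by linarith)).symm
      _ ≤ (b : ℝ) ^ (1 + Real.logb b ρ) :=
          Real.rpow_le_rpow_of_exponent_le (by linarith) (by linarith)
      _ ≤ _ := Real.rpow_le_rpow (by linarith) (by linarith) (by linarith)
  · right
    have hkb : (((k / b : ℕ) : ℕ) : ℝ) = k / b := Nat.cast_div hbk (by positivity)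
    have hnb : (((n / b : ℕ) : ℕ) : ℝ) = n / b := Nat.cast_div hbn (by positivity)
    have h1 : (N : ℝ) ≤ (Real.exp 1 * ρ) ^ (k / b) := by
      refine le_trans (by exact_mod_cast hN) ((Nat.choose_le_exp_mul_div_pow _ _).trans_eq ?_)
      rw [hkb, hnb, mul_div_assoc, div_div_div_cancel_right₀ (by positivity)]
    refine h1.trans ?_
    rw [← Real.rpow_natCast, hkb, Real.rpow_def_of_pos (by positivity),
      Real.rpow_def_of_pos (by positivity), Real.exp_le_exp,
      Real.log_mul (Real.exp_ne_zero 1) (by positivity), Real.log_exp]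
    have hlog := log_twelve_mul_le hu12 hbu
    have hlb : 0 < Real.log b := Real.log_pos (by linarith)
    have hsplit : Real.log (12 * b) = Real.log 12 + Real.log b :=
      Real.log_mul (by norm_num) (by positivity)
    have h12 : 1 ≤ Real.log 12 := by
      rw [Real.le_log_iff_exp_le (by norm_num)]
      linarith [Real.exp_one_lt_three]
    have hρlog : Real.logb b ρ * Real.log b = Real.log ρ := by
      rw [Real.logb, div_mul_cancel₀ _ hlb.ne']
    have hlogρ : 0 ≤ Real.log ρ := Real.log_nonneg hρ
    have hmain : 1 + Real.log ρ ≤ 2 * (1 + Real.logb b ρ) * Real.log (12 * b) := by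
      rw [hsplit]
      nlinarith [mul_nonneg hlogb (by linarith : 0 ≤ Real.log 12)]
    have hus : u * s = k := by rw [hu]; field_simp
    calc (1 + Real.log ρ) * (k / b)
        ≤ (2 * (1 + Real.logb b ρ) * Real.log (12 * b)) * (k / b) := by gcongr
      _ = (u * (Real.log (12 * b) / b)) * (2 * (1 + Real.logb b ρ) * s) := by
          rw [← hus]; ring
      _ ≤ _ := by gcongr

theorem one_le_div_logb_two {x : ℝ} (hx : 1 < x) : 1 ≤ x / Real.logb 2 x := by
  have h0 : 0 < Real.logb 2 x := Real.logb_pos (by norm_num) hx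
  rw [le_div_iff₀ h0, one_mul, Real.logb_le_iff_le_rpow (by norm_num) (by linarith)]
  -- Bernoulli: `1 + x ≤ 2 ^ x`.
  have := one_add_mul_self_le_rpow_one_add (s := 1) (by norm_num) hx.le
  norm_num at this
  linarith

/-- With `L = log₂(n/k)`, the identity `L ^ (L / log₂ L) = 2 ^ L = n/k` settles `k/s ≥ L`. Below
that scale the bound `4 ^ k` on the model suffices: its logarithm is `2k log 2`, exactly what the
exponent yields with `log L / L` in place of `log (12L) / L`. -/
theorem tree_count {n k : ℕ} (hk : 1 ≤ k) (hkn : 2 * k < n) (N : ℕ) (hN : N ≤ 4 ^ k) (s : ℕ)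
    (hs : 1 ≤ s) (hsk : s ≤ 2 * k) :
    (n / k : ℝ) ≤
      (12 * k / s : ℝ) ^ (Real.logb 2 (n / k) / Real.logb 2 (Real.logb 2 (n / k))) ∨
    (N : ℝ) ≤ (12 * k / s : ℝ) ^
      (2 * (Real.logb 2 (n / k) / Real.logb 2 (Real.logb 2 (n / k))) * s) := by
  have hk' : (1 : ℝ) ≤ k := by exact_mod_cast hk
  have hs' : (1 : ℝ) ≤ s := by exact_mod_cast hs
  have hsk' : (s : ℝ) ≤ 2 * k := by exact_mod_cast hsk
  have hkn' : 2 * (k : ℝ) < n := by exact_mod_cast hkn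
  have hρ : (2 : ℝ) < n / k := by rw [lt_div_iff₀ (by linarith)]; linarith
  set ρ : ℝ := n / k
  set L := Real.logb 2 ρ with hL
  have hL1 : 1 < L := by
    rw [hL, Real.lt_logb_iff_rpow_lt (by norm_num) (by linarith), Real.rpow_one]
    exact hρ
  have hLL : 0 < Real.logb 2 L := Real.logb_pos (by norm_num) hL1
  set u : ℝ := k / s with hu
  have hu12 : 1 / 2 ≤ u := by rw [hu, div_le_div_iff₀ (by norm_num) (by linarith)]; linarith
  rw [mul_div_assoc]
  rcases le_total L u with hLu | hLu
  · left
    calc ρ = (2 : ℝ) ^ L := (Real.rpow_logb (by norm_num) (by norm_num) (by linarith)).symm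
      _ = (2 : ℝ) ^ (Real.logb 2 L * (L / Real.logb 2 L)) := by
          rw [mul_div_cancel₀ _ hLL.ne']
      _ = L ^ (L / Real.logb 2 L) := by
          rw [Real.rpow_mul (by norm_num), Real.rpow_logb (by norm_num) (by norm_num) (by linarith)]
      _ ≤ _ := Real.rpow_le_rpow (by linarith) (by linarith) (by positivity)
  · right
    have h1 : (N : ℝ) ≤ (4 : ℝ) ^ k := by exact_mod_cast hN
    refine h1.trans ?_
    have h4 : Real.log 4 = 2 * Real.log 2 := by
      rw [show (4 : ℝ) = 2 ^ 2 by norm_num, Real.log_pow]; norm_num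
    rw [← Real.rpow_natCast, Real.rpow_def_of_pos (by norm_num),
      Real.rpow_def_of_pos (by positivity), Real.exp_le_exp, h4]
    have hlog := log_twelve_mul_le hu12 hLu
    have hlogL : 0 < Real.log L := Real.log_pos hL1
    have hlog12 : Real.log L ≤ Real.log (12 * L) := Real.log_le_log (by linarith) (by linarith)
    have hl2 : 0 < Real.log 2 := Real.log_pos (by norm_num)
    have hus : u * s = k := by rw [hu]; field_simp
    calc 2 * Real.log 2 * k = (u * (Real.log L / L)) * (2 * (L / Real.logb 2 L) * s) := by
          rw [← hus, Real.logb]; field_simp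
      _ ≤ (u * (Real.log (12 * L) / L)) * (2 * (L / Real.logb 2 L) * s) := by gcongr
      _ ≤ _ := by gcongr

theorem mainTheorem9 :
    ∃ (c C K : ℝ) (a : ℕ), 0 < c ∧ 0 < C ∧ 0 < K ∧
      ∀ ε : ℝ, 0 < ε → ε < 1 / 2 →
        -- block sparsity
        (∀ n k b : ℕ, 1 ≤ k → k ≤ n → 2 ≤ b → b ∣ k → b ∣ n →
          ∀ β : Fin n → Fin (n / b), IsBlockPartition b β →
            ∃ m : ℕ,
              (m : ℝ) ≤ C / ε ^ 2 * ((k : ℝ) * (1 + Real.logb (b : ℝ) ((n : ℝ) / (k : ℝ)))) ∧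
              StableRecovery (blockModel k b β) m (3 + c * ε) (2 ^ (a * n))) ∧
        -- tree sparsity
        (∀ h n k : ℕ, n = 2 ^ (h + 1) - 1 → 1 ≤ k → 2 * k < n →
          K * Real.logb 2 (n : ℝ) ≤ (k : ℝ) →
            ∃ m : ℕ,
              (m : ℝ) ≤ C / ε ^ 2 * ((k : ℝ) * (Real.logb 2 ((n : ℝ) / (k : ℝ)) /
                Real.logb 2 (Real.logb 2 ((n : ℝ) / (k : ℝ))))) ∧
              StableRecovery (treeModel n k) m (3 + c * ε) (2 ^ (a * n))) := by
  refine ⟨4, 1000, 1, 9, by norm_num, by norm_num, by norm_num, fun ε hε hε1 => ⟨?_, ?_⟩⟩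
  · intro n k b hk hkn hb hbk hbn β hβ
    refine exists_stableRecovery (blockModel k b β) ε _ hε hε1 hk hkn
      (card_le_of_mem_blockModel hbk β hβ) ?_
      fun s hs hsk => block_count hk hkn hb hbk hbn _ (ncard_blockModel_le k b β) s hs hsk
    have hk' : (0 : ℝ) < k := by exact_mod_cast hk
    have hkn' : (k : ℝ) ≤ n := by exact_mod_cast hkn
    have hb' : (1 : ℝ) < b := by exact_mod_cast hb
    have := Real.logb_nonneg hb' ((one_le_div hk').2 hkn')
    linarith
  · intro h n k _ hk hkn _
    refine exists_stableRecovery (treeModel n k) ε _ hε hε1 hk (by omega)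
      (fun T hT => hT.1.le) (one_le_div_logb_two ?_)
      fun s hs hsk => tree_count hk hkn _ (ncard_treeModel_le n k) s hs hsk
    have hk' : (0 : ℝ) < k := by exact_mod_cast hk
    have hkn' : 2 * (k : ℝ) < n := by exact_mod_cast hkn
    -- Then `log₂(n/k) > 1`, so the iterated logarithm in the denominator is positive.
    have hρ : (2 : ℝ) < n / k := (lt_div_iff₀ hk').2 hkn'
    rwa [Real.lt_logb_iff_rpow_lt (by norm_num) (by linarith), Real.rpow_one]
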